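/- \textbf{Setting.} Let $\mathbb{X}\subset\mathbb{R}^d$ be a Borel set (the state space), let $\mathbb{U}\subset\mathbb{R}^m$ be a compact set (the action space), and let $c:\mathbb{X}\times\mathbb{U}\to\mathbb{R}$ be Borel measurable and bounded, with $u\mapsto c(x,u)$ continuous for every fixed $x$. Let $\mathcal{T}$ and $\mathcal{T}_n$, $n\in\mathbb{N}$, be stochastic kernels from $\mathbb{X}\times\mathbb{U}$ to $\mathbb{X}$. An admissible policy $\gamma$ is a sequence of measurable functions $\gamma_t$ with $U_t=\gamma_t(X_0,\dots,X_t,U_0,\dots,U_{t-1})\in\mathbb{U}$; it is stationary if $U_t=\gamma(X_t)$ for a fixed measurable $\gamma:\mathbb{X}\to\mathbb{U}$. Put $$J_\infty(\mathcal{T},\gamma,x)=\limsup_{N\to\infty}\frac1N E_x^{\mathcal{T},\gamma}\Big[\sum_{t=0}^{N-1}c(X_t,U_t)\Big],\qquad J^*_\infty(\mathcal{T},x)=\inf_\gamma J_\infty(\mathcal{T},\gamma,x),$$ where the controlled process starts from $X_0=x$, has $X_{t+1}\sim\mathcal{T}(\cdot|X_t,U_t)$ given the past, and the infimum is over all admissible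 policies. For a stationary $\gamma$ let $\mathcal{T}^t(\cdot|x,\gamma)$ be the $t$-step transition kernel of the resulting chain. A sequence $\mu_n$ of probability measures converges setwise to $\mu$ if $\int f\,d\mu_n\to\int f\,d\mu$ for every bounded measurable $f$, and $\|\mu-\nu\|_{TV}=\sup_{\|f\|_\infty\le1}|\int f\,d\mu-\int f\,d\nu|$. \textbf{Theorem.} Assume the following. (1) There are an integer $t\ge1$ and a number $0<\beta<1$ such that, for $\mathcal{S}=\mathcal{T}$ and for $\mathcal{S}=\mathcal{T}_n$ with every $n$, $\|\mathcal{S}^t(\cdot|x,\gamma)-\mathcal{S}^t(\cdot|x',\gamma)\|_{TV}\le2\beta$ for all $x,x'\in\mathbb{X}$ and all stationary policies $\gamma$. (2) For every $x\in\mathbb{X}$, $\mathcal{T}(\cdot|x,u)$ is setwise continuous in $u$, that is, $\mathcal{T}(\cdot|x,u_k)\to\mathcal{T}(\cdot|x,u)$ setwise whenever $u_k\to u$ in $\mathbb{U}$. (3) For every $x\in\mathbb{X}$ and every sequence $u_n\to u$ in $\mathbb{U}$, $\mathcal{T}_n(\cdot|x,u_n)\to\mathcal{T}(\cdot|x,u)$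 setwise. For each $n$ let $\gamma_n^*$ be a stationary policy satisfying the average cost optimality equation of $\mathcal{T}_n$: there are a constant $j_n^*$ and a bounded measurable $v_n^*:\mathbb{X}\to\mathbb{R}$ such that for all $x\in\mathbb{X}$ $$j_n^*+v_n^*(x)=\inf_{u\in\mathbb{U}}\Big(c(x,u)+\int v_n^*(y)\,\mathcal{T}_n(dy|x,u)\Big)=c(x,\gamma_n^*(x))+\int v_n^*(y)\,\mathcal{T}_n(dy|x,\gamma_n^*(x)).$$ Then $J_\infty(\mathcal{T},\gamma_n^*,x)\to J_\infty^*(\mathcal{T},x)$ as $n\to\infty$ for every $x\in\mathbb{X}$. -/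

import Mathlib

open Filter Topology MeasureTheory ProbabilityTheory

namespace AvgMDP

variable {X U : Type*} [MeasurableSpace X] [MeasurableSpace U]

/-- The information variable `I_t = (X_{[0,t]}, U_{[0,t-1]})`. -/
abbrev History (X U : Type*) (t : ℕ) : Type _ := (Fin (t + 1) → X) × (Fin t → U)

/-- Admissible policies: sequences of control functions, the `t`-th one being a measurable function
of the information `I_t`, with `U_t = γ_t(I_t)`. -/
structure AdmissiblePolicy (X U : Type*) [MeasurableSpace X] [MeasurableSpace U] where
  act : ∀ t : ℕ, History X U t → U
  measurable_act : ∀ t : ℕ, Measurable (act t)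

/-- Stationary policies: measurable functions of the current state. -/
structure StationaryPolicy (X U : Type*) [MeasurableSpace X] [MeasurableSpace U] where
  act : X → U
  measurable_act : Measurable act

/-- A stationary policy, seen as an admissible policy: `U_t = g(X_t)`. -/
def StationaryPolicy.toAdmissible (g : StationaryPolicy X U) : AdmissiblePolicy X U where
  act t h := g.act (h.1 (Fin.last t))
  measurable_act t := g.measurable_act.comp ((measurable_pi_apply (Fin.last t)).comp measurable_fst)

/-- The conditional law of `X_{t+1}` given `I_t = h`, namely `T(· | X_t, γ_t(h))`. -/
noncomputable def nextState (T : Kernel (X × U) X) (γ : AdmissiblePolicy X U) (t : ℕ) :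
    Kernel (History X U t) X :=
  T.comap (fun h => (h.1 (Fin.last t), γ.act t h))
    (((measurable_pi_apply (Fin.last t)).comp measurable_fst).prodMk (γ.measurable_act t))

/-- The joint law of `I_t = (X_0, …, X_t, U_0, …, U_{t-1})` under the transition kernel `T` and the
policy `γ`, started from the state `x`. -/
noncomputable def histLaw (T : Kernel (X × U) X) (γ : AdmissiblePolicy X U) (x : X) :
    (t : ℕ) → Measure (History X U t)
  | 0 => Measure.dirac (fun _ => x, Fin.elim0)
  | t + 1 => (histLaw T γ x t ⊗ₘ nextState T γ t).map
      (fun p => (Fin.snoc (α := fun _ => X) p.1.1 p.2,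
        Fin.snoc (α := fun _ => U) p.1.2 (γ.act t p.1)))

/-- The expected total cost `E_x[∑_{t < N} c(X_t, U_t)]`. -/
noncomputable def finiteCost (c : X → U → ℝ) (T : Kernel (X × U) X) (γ : AdmissiblePolicy X U)
    (N : ℕ) (x : X) : ℝ :=
  ∫ h, ∑ t : Fin N, c (h.1 t.castSucc) (h.2 t) ∂(histLaw T γ x N)

/-- The infinite-horizon average cost `J_∞(T, γ, x)`. -/
noncomputable def avgCost (c : X → U → ℝ) (T : Kernel (X × U) X) (γ : AdmissiblePolicy X U)
    (x : X) : ℝ :=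
  limsup (fun N : ℕ => (1 / (N : ℝ)) * finiteCost c T γ N x) atTop

/-- The optimal average cost `J_∞^*(T, x)`, the infimum over all admissible policies. -/
noncomputable def optAvgCost (c : X → U → ℝ) (T : Kernel (X × U) X) (x : X) : ℝ :=
  ⨅ γ : AdmissiblePolicy X U, avgCost c T γ x

/-- The transition kernel `T(· | x, g(x))` under a stationary policy `g`. -/
noncomputable def closedLoop (T : Kernel (X × U) X) (g : StationaryPolicy X U) : Kernel X X :=
  T.comap (fun x => (x, g.act x)) (measurable_id.prodMk g.measurable_act)

/-- The `t`-step transition kernel `T^t(· | x, g)` under a stationary policy `g`. -/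
noncomputable def stepKernel (T : Kernel (X × U) X) (g : StationaryPolicy X U) : ℕ → Kernel X X
  | 0 => Kernel.id
  | t + 1 => closedLoop T g ∘ₖ stepKernel T g t

/-- The total variation distance `sup_{‖f‖_∞ ≤ 1} |∫ f dμ - ∫ f dν|` (with values in `[0,2]` on
probability measures). -/
noncomputable def tvDistance (μ ν : Measure X) : ℝ :=
  sSup {r : ℝ | ∃ f : X → ℝ, Measurable f ∧ (∀ x, |f x| ≤ 1) ∧ r = |∫ x, f x ∂μ - ∫ x, f x ∂ν|}

/-- The ergodicity condition `‖T^t(· | x, g) - T^t(· | x', g)‖_TV ≤ 2β` for all states `x, x'` and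
all stationary policies `g`. -/
def ErgodicityCondition (T : Kernel (X × U) X) (t : ℕ) (β : ℝ) : Prop :=
  ∀ (g : StationaryPolicy X U) (x x' : X),
    tvDistance (stepKernel T g t x) (stepKernel T g t x') ≤ 2 * β

/-- Setwise convergence: convergence of the integrals of all bounded measurable functions. -/
def SetwiseTendsto (μ : ℕ → Measure X) (ν : Measure X) : Prop :=
  ∀ f : X → ℝ, Measurable f → (∃ K : ℝ, ∀ x, |f x| ≤ K) →
    Tendsto (fun n => ∫ x, f x ∂(μ n)) atTop (𝓝 (∫ x, f x ∂ν))

/-- The stationary policy `g` satisfies the average cost optimality equation (ACOE) of the kernel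
`T`: for some constant `j` and some bounded measurable `v`, for all `x`,
`j + v(x) = inf_u (c(x,u) + ∫ v(y) T(dy | x,u)) = c(x,g(x)) + ∫ v(y) T(dy | x,g(x))`. -/
def SatisfiesACOE (c : X → U → ℝ) (T : Kernel (X × U) X) (g : StationaryPolicy X U) : Prop :=
  ∃ (j : ℝ) (v : X → ℝ), Measurable v ∧ (∃ K : ℝ, ∀ x, |v x| ≤ K) ∧
    ∀ x, j + v x = ⨅ u : U, (c x u + ∫ y, v y ∂(T (x, u))) ∧
      j + v x = c x (g.act x) + ∫ y, v y ∂(T (x, g.act x))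

end AvgMDP

/-! Setwise convergence is too weak to extract a limit from the relative value functions `v n` of
the approximating models, so they are compared with a fixed function instead. Let `h` solve the
optimality equation of `T` up to an error `δ`, with constant `j` and a near-optimal policy `g`, and
put `f n = v n - h`. Inserting `g` into the equation of `Tn n`, and `γ n` into that of `T`, shows
that `f n` is almost subharmonic for `Tn n` under `g` and almost superharmonic under `γ n`. The
errors are of order `δ` plus null sequences: uniformly bounded functions tending to `0` pointwise.
Compactness of the action space makes null sequences stable under the kernels with arbitrary
policies (`IsNull.op_closedLoop`).

The core is `exists_isNull_sub_op_le`: `f n` is asymptotically almost constant. By ergodicity, `f n`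
lies almost below its mean `a n` after many steps under `g`, and almost above its mean `b n` under
`γ n`. Hence after these steps it is mostly near `a n`, respectively near `b n`. If `a n` exceeded
`b n` substantially, a policy following `g` at high values of `f n` and `γ n` at low ones would keep
both starting distributions near their levels for `t` steps, although its `t`-step kernel contracts
oscillations by `β`.

Consequently `h` satisfies a Poisson inequality for `γ n` under `T` itself, with excess a small
constant plus a null sequence (`exists_isNull_excess`). Ergodicity makes the null part negligible in
the long-run average (`eventually_avgCost_le`), while `h` also bounds the optimal cost from below
(`le_optAvgCost`). -/

namespace AvgMDP

/-! ### Kernels acting on bounded functions, and contraction of oscillations. -/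

section Operators

variable {X U : Type*} [MeasurableSpace X] [MeasurableSpace U]

/-- Bounded measurable real functions. -/
structure IsBM (f : X → ℝ) : Prop where
  meas : Measurable f
  bdd : ∃ C : ℝ, ∀ x, |f x| ≤ C

theorem IsBM.const (r : ℝ) : IsBM (fun _ : X => r) :=
  ⟨measurable_const, |r|, fun _ => le_rfl⟩

theorem IsBM.add {f g : X → ℝ} (hf : IsBM f) (hg : IsBM g) : IsBM (fun x => f x + g x) := by
  obtain ⟨C, hC⟩ := hf.bdd
  obtain ⟨D, hD⟩ := hg.bdd
  exact ⟨hf.meas.add hg.meas, C + D, fun x => (abs_add_le _ _).trans (add_le_add (hC x) (hD x))⟩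

theorem IsBM.neg {f : X → ℝ} (hf : IsBM f) : IsBM (fun x => - f x) := by
  obtain ⟨C, hC⟩ := hf.bdd
  exact ⟨hf.meas.neg, C, fun x => by rw [abs_neg]; exact hC x⟩

theorem IsBM.sub {f g : X → ℝ} (hf : IsBM f) (hg : IsBM g) : IsBM (fun x => f x - g x) := by
  simpa only [sub_eq_add_neg] using hf.add hg.neg

theorem IsBM.const_mul {f : X → ℝ} (r : ℝ) (hf : IsBM f) : IsBM (fun x => r * f x) := by
  obtain ⟨C, hC⟩ := hf.bdd
  refine ⟨hf.meas.const_mul r, |r| * C, fun x => ?_⟩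
  rw [abs_mul]
  exact mul_le_mul_of_nonneg_left (hC x) (abs_nonneg r)

theorem IsBM.abs {f : X → ℝ} (hf : IsBM f) : IsBM (fun x => |f x|) := by
  obtain ⟨C, hC⟩ := hf.bdd
  exact ⟨hf.meas.abs, C, fun x => by rw [abs_abs]; exact hC x⟩

theorem IsBM.integrable {f : X → ℝ} (hf : IsBM f) (μ : Measure X) [IsFiniteMeasure μ] :
    Integrable f μ := by
  obtain ⟨C, hC⟩ := hf.bdd
  exact Integrable.of_bound hf.meas.aestronglyMeasurable C (Eventually.of_forall hC)

/-- The action of a kernel on functions, `f ↦ ∫ f(y) P(dy | x)`. -/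
noncomputable def op (P : Kernel X X) (f : X → ℝ) (x : X) : ℝ := ∫ y, f y ∂(P x)

theorem IsBM.op {f : X → ℝ} (hf : IsBM f) (P : Kernel X X) [IsMarkovKernel P] :
    IsBM (op P f) := by
  obtain ⟨C, hC⟩ := hf.bdd
  refine ⟨(hf.meas.stronglyMeasurable.integral_kernel (κ := P)).measurable, C, fun x => ?_⟩
  have := norm_integral_le_of_norm_le_const (μ := P x) (f := f) (Eventually.of_forall hC)
  simpa [AvgMDP.op] using this

theorem op_neg (P : Kernel X X) (f : X → ℝ) (x : X) : op P (fun x => - f x) x = - op P f x :=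
  integral_neg f

theorem op_const_mul (P : Kernel X X) (r : ℝ) (f : X → ℝ) (x : X) :
    op P (fun x => r * f x) x = r * op P f x :=
  integral_const_mul r f

section

variable (P : Kernel X X) [IsMarkovKernel P]

theorem op_mono {f g : X → ℝ} (hf : IsBM f) (hg : IsBM g) (h : ∀ x, f x ≤ g x) (x : X) :
    op P f x ≤ op P g x :=
  integral_mono (hf.integrable _) (hg.integrable _) h

theorem op_const (r : ℝ) (x : X) : op P (fun _ => r) x = r := by
  simp [op]

theorem op_add {f g : X → ℝ} (hf : IsBM f) (hg : IsBM g) (x : X) :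
    op P (fun x => f x + g x) x = op P f x + op P g x :=
  integral_add (hf.integrable _) (hg.integrable _)

theorem op_sub {f g : X → ℝ} (hf : IsBM f) (hg : IsBM g) (x : X) :
    op P (fun x => f x - g x) x = op P f x - op P g x :=
  integral_sub (hf.integrable _) (hg.integrable _)

theorem op_le {f : X → ℝ} (hf : IsBM f) {r : ℝ} (h : ∀ x, f x ≤ r) (x : X) : op P f x ≤ r :=
  (op_mono P hf (IsBM.const r) h x).trans_eq (op_const P r x)

theorem le_op {f : X → ℝ} (hf : IsBM f) {r : ℝ} (h : ∀ x, r ≤ f x) (x : X) : r ≤ op P f x :=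
  (op_const P r x).symm.trans_le (op_mono P (IsBM.const r) hf h x)

theorem abs_op_le {f : X → ℝ} (hf : IsBM f) {r : ℝ} (h : ∀ x, |f x| ≤ r) (x : X) :
    |op P f x| ≤ r :=
  abs_le.2 ⟨le_op P hf (fun x => (abs_le.1 (h x)).1) x, op_le P hf (fun x => (abs_le.1 (h x)).2) x⟩

end

/-- Functions that vary by at most `s` have averages that differ by at most `s`. -/
theorem op_sub_op_le_of_osc (P Q : Kernel X X) [IsMarkovKernel P] [IsMarkovKernel Q] {f : X → ℝ}
    (hf : IsBM f) {s : ℝ} (hs : ∀ x x', f x - f x' ≤ s) (x x' : X) :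
    op P f x - op Q f x' ≤ s := by
  have : Nonempty X := ⟨x⟩
  obtain ⟨C, hC⟩ := hf.bdd
  have hb : BddBelow (Set.range f) := ⟨-C, by rintro _ ⟨y, rfl⟩; exact (abs_le.1 (hC y)).1⟩
  have h1 : op P f x ≤ (⨅ y, f y) + s := op_le P hf (fun y => by
    have : f y - s ≤ ⨅ y, f y := le_ciInf fun z => by linarith [hs y z]
    linarith) x
  have h2 : (⨅ y, f y) ≤ op Q f x' := le_op Q hf (fun y => ciInf_le hb y) x'
  linarith

instance (T : Kernel (X × U) X) [IsMarkovKernel T] (g : StationaryPolicy X U) :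
    IsMarkovKernel (closedLoop T g) := by
  unfold closedLoop; infer_instance

instance (T : Kernel (X × U) X) [IsMarkovKernel T] (g : StationaryPolicy X U) (k : ℕ) :
    IsMarkovKernel (stepKernel T g k) := by
  induction k with
  | zero => unfold stepKernel; infer_instance
  | succ k ih => unfold stepKernel; infer_instance

theorem op_closedLoop (T : Kernel (X × U) X) (g : StationaryPolicy X U) (f : X → ℝ)
    (x : X) :
    op (closedLoop T g) f x = ∫ y, f y ∂(T (x, g.act x)) := rfl

theorem op_stepKernel_zero (T : Kernel (X × U) X) (g : StationaryPolicy X U) {f : X → ℝ} (hf : IsBM f)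
    (x : X) :
    op (stepKernel T g 0) f x = f x := by
  simp only [op, stepKernel, Kernel.id_apply]
  exact integral_dirac' f x hf.meas.stronglyMeasurable

section

variable (T : Kernel (X × U) X) [IsMarkovKernel T] (g : StationaryPolicy X U)

theorem op_stepKernel_succ {f : X → ℝ} (hf : IsBM f) (k : ℕ) (x : X) :
    op (stepKernel T g (k + 1)) f x = op (stepKernel T g k) (op (closedLoop T g) f) x := by
  simp only [op, stepKernel]
  exact Kernel.integral_comp (hf.integrable _)

theorem op_stepKernel_add {f : X → ℝ} (hf : IsBM f) (k m : ℕ) (x : X) :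
    op (stepKernel T g (k + m)) f x = op (stepKernel T g k) (op (stepKernel T g m) f) x := by
  induction m generalizing f with
  | zero => rw [add_zero, funext (op_stepKernel_zero T g hf)]
  | succ m ih =>
    rw [← add_assoc, op_stepKernel_succ T g hf, ih (hf.op _), funext (op_stepKernel_succ T g hf m)]

theorem op_stepKernel_succ' {f : X → ℝ} (hf : IsBM f) (k : ℕ) (x : X) :
    op (stepKernel T g (k + 1)) f x = op (closedLoop T g) (op (stepKernel T g k) f) x := by
  rw [add_comm, op_stepKernel_add T g hf, op_stepKernel_succ T g (hf.op _), op_stepKernel_zero]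
  exact (hf.op _).op _

end

theorem abs_integral_sub_le_tvDistance (μ ν : Measure X) [IsProbabilityMeasure μ]
    [IsProbabilityMeasure ν] {f : X → ℝ} (hf : Measurable f) (h : ∀ x, |f x| ≤ 1) :
    |∫ x, f x ∂μ - ∫ x, f x ∂ν| ≤ tvDistance μ ν := by
  -- The bound `2` matters: a real `sSup` of an unbounded set has the default value `0`.
  refine le_csSup ⟨2, ?_⟩ ⟨f, hf, h, rfl⟩
  rintro _ ⟨φ, -, hφ, rfl⟩
  have h1 := norm_integral_le_of_norm_le_const (μ := μ) (f := φ) (Eventually.of_forall hφ)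
  have h2 := norm_integral_le_of_norm_le_const (μ := ν) (f := φ) (Eventually.of_forall hφ)
  simp only [Real.norm_eq_abs, probReal_univ, mul_one] at h1 h2
  exact (abs_sub _ _).trans (by linarith)

/-- Subtracting the midpoint of its range leaves a function of norm at most `s / 2`, so the total
variation bound `2 * β` becomes a contraction factor `β`. The case `s = 0` is separate because of
the rescaling by `2 / s`. -/
theorem ErgodicityCondition.osc_le {T : Kernel (X × U) X} [IsMarkovKernel T] {t : ℕ} {β : ℝ}
    (hT : ErgodicityCondition T t β) (g : StationaryPolicy X U) {f : X → ℝ} (hf : IsBM f) {s : ℝ}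
    (hs : ∀ x x', f x - f x' ≤ s) (x x' : X) :
    op (stepKernel T g t) f x - op (stepKernel T g t) f x' ≤ β * s := by
  have : Nonempty X := ⟨x⟩
  obtain ⟨C, hC⟩ := hf.bdd
  have hb : BddBelow (Set.range f) := ⟨-C, by rintro _ ⟨y, rfl⟩; exact (abs_le.1 (hC y)).1⟩
  set i := ⨅ y, f y
  have h1 (y : X) : i ≤ f y := ciInf_le hb y
  have h2 (y : X) : f y ≤ i + s := by
    have : f y - s ≤ i := le_ciInf fun z => by linarith [hs y z]
    linarith
  have hs0 : 0 ≤ s := by linarith [h1 x, h2 x]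
  rcases hs0.eq_or_lt with h0 | h0
  · have := op_sub_op_le_of_osc (stepKernel T g t) (stepKernel T g t) hf hs x x'
    rw [← h0] at this ⊢; simpa using this
  · set φ : X → ℝ := fun y => (2 / s) * (f y - (i + s / 2)) with hφ
    have hbm : IsBM (fun y => f y - (i + s / 2)) := hf.sub (IsBM.const _)
    have hφ1 (y : X) : |φ y| ≤ 1 := by
      rw [hφ]
      simp only [abs_mul, abs_of_pos (show 0 < 2 / s by positivity)]
      rw [div_mul_eq_mul_div, div_le_one h0]
      have : |f y - (i + s / 2)| ≤ s / 2 := abs_le.2 ⟨by linarith [h1 y], by linarith [h2 y]⟩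
      linarith
    have h3 := (abs_integral_sub_le_tvDistance (stepKernel T g t x) (stepKernel T g t x')
      (hbm.const_mul (2 / s)).meas hφ1).trans (hT g x x')
    have h4 (z : X) : ∫ y, φ y ∂(stepKernel T g t z)
        = (2 / s) * (op (stepKernel T g t) f z - (i + s / 2)) := by
      have := op_const_mul (stepKernel T g t) (2 / s) (fun y => f y - (i + s / 2)) z
      rw [op_sub _ hf (IsBM.const _), op_const] at this
      exact this
    rw [h4, h4, ← mul_sub] at h3
    have h5 := (le_abs_self _).trans h3
    rw [div_mul_eq_mul_div, div_le_iff₀ h0] at h5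
    linarith

theorem ErgodicityCondition.osc_pow_le {T : Kernel (X × U) X} [IsMarkovKernel T] {t : ℕ} {β : ℝ}
    (hT : ErgodicityCondition T t β) (g : StationaryPolicy X U) {f : X → ℝ} (hf : IsBM f) {s : ℝ}
    (hs : ∀ x x', f x - f x' ≤ s) (p : ℕ) (x x' : X) :
    op (stepKernel T g (t * p)) f x - op (stepKernel T g (t * p)) f x' ≤ β ^ p * s := by
  induction p generalizing x x' with
  | zero =>
    simp only [mul_zero, pow_zero, one_mul]
    rw [op_stepKernel_zero T g hf, op_stepKernel_zero T g hf]
    exact hs x x'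
  | succ p ih =>
    have := hT.osc_le g (hf.op (stepKernel T g (t * p))) ih x x'
    rw [← op_stepKernel_add T g hf, ← op_stepKernel_add T g hf] at this
    rw [mul_add, mul_one, add_comm, pow_succ']
    linarith

/-- An approximate solution of a (discounted or undiscounted) Poisson equation has a span that is
bounded in terms of the cost and the ergodicity constants. -/
theorem ErgodicityCondition.span_le {T : Kernel (X × U) X} [IsMarkovKernel T] {t : ℕ} {β : ℝ}
    (hT : ErgodicityCondition T t β) (hβ : 0 < β) (hβ1 : β < 1) (g : StationaryPolicy X U)
    {h : X → ℝ} (hh : IsBM h) {α j D : ℝ} (hα0 : 0 ≤ α) (hα1 : α ≤ 1)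
    (hD : ∀ x, |h x - (α * op (closedLoop T g) h x - j)| ≤ D) (x x' : X) :
    h x - h x' ≤ 2 * t * D / (1 - β) := by
  have hD0 : 0 ≤ D := (abs_nonneg _).trans (hD x)
  have key (k : ℕ) : ∃ r : ℝ, ∀ y, |h y - (α ^ k * op (stepKernel T g k) h y + r)| ≤ k * D := by
    induction k with
    | zero => exact ⟨0, fun y => by simp [op_stepKernel_zero T g hh]⟩
    | succ k ih =>
      obtain ⟨r, hr⟩ := ih
      refine ⟨α * r - j, fun y => ?_⟩
      have e : IsBM (fun z => h z - (α ^ k * op (stepKernel T g k) h z + r)) :=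
        hh.sub (((hh.op _).const_mul _).add (IsBM.const _))
      have h1 := abs_op_le (closedLoop T g) e hr y
      rw [op_sub _ hh (((hh.op _).const_mul _).add (IsBM.const _)),
        op_add _ ((hh.op _).const_mul _) (IsBM.const _), op_const, op_const_mul,
        ← op_stepKernel_succ' T g hh] at h1
      have h2 := hD y
      have h3 : |α * (op (closedLoop T g) h y - (α ^ k * op (stepKernel T g (k + 1)) h y + r))|
          ≤ k * D := by
        rw [abs_mul, abs_of_nonneg hα0]
        exact (mul_le_of_le_one_left (abs_nonneg _) hα1).trans h1
      have := (abs_add_le _ _).trans (add_le_add h2 h3)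
      push_cast
      calc _ = |h y - (α * op (closedLoop T g) h y - j) + α * (op (closedLoop T g) h y -
            (α ^ k * op (stepKernel T g (k + 1)) h y + r))| := by congr 1; ring
        _ ≤ _ := by linarith
  obtain ⟨r, hr⟩ := key t
  have : Nonempty X := ⟨x⟩
  obtain ⟨C, hC⟩ := hh.bdd
  set s := ⨆ q : X × X, h q.1 - h q.2
  have hb : BddAbove (Set.range fun q : X × X => h q.1 - h q.2) := by
    refine ⟨C + C, ?_⟩
    rintro _ ⟨q, rfl⟩
    have := abs_le.1 (hC q.1)
    have := abs_le.1 (hC q.2)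
    simp only
    linarith
  have hs (y y' : X) : h y - h y' ≤ s := le_ciSup hb (y, y')
  have hs0 : 0 ≤ s := by simpa using hs x x
  have h1 : s ≤ β * s + 2 * t * D := ciSup_le fun q => by
    have h2 := abs_le.1 (hr q.1)
    have h3 := abs_le.1 (hr q.2)
    have h4 := hT.osc_le g hh hs q.1 q.2
    have h5 : α ^ t * (op (stepKernel T g t) h q.1 - op (stepKernel T g t) h q.2) ≤ β * s :=
      (mul_le_mul_of_nonneg_left h4 (by positivity)).trans
        (mul_le_of_le_one_left (by positivity) (pow_le_one₀ hα0 hα1))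
    rw [mul_sub] at h5
    linarith
  refine (hs x x').trans ?_
  rw [le_div_iff₀ (by linarith)]
  linarith

end Operators

/-! ### Null sequences and their stability under continuously converging kernels. -/

section NullSequences

/-- Continuous convergence on a compact space needs no convergence of the arguments. Every
subsequence of `w` has a convergent further subsequence, which is completed to a full convergent
sequence by inserting its limit at the remaining indices. -/
theorem tendsto_zero_of_continuous_convergence {U : Type*} [TopologicalSpace U] [CompactSpace U]
    [FirstCountableTopology U] {F : ℕ → U → ℝ}
    (hF : ∀ (w : ℕ → U) (u : U), Tendsto w atTop (𝓝 u) →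
      Tendsto (fun n => F n (w n)) atTop (𝓝 0)) (w : ℕ → U) :
    Tendsto (fun n => F n (w n)) atTop (𝓝 0) := by
  classical
  refine tendsto_of_subseq_tendsto fun ns hns => ?_
  obtain ⟨φ, -, hφ⟩ := strictMono_subseq_of_tendsto_atTop hns
  obtain ⟨u, ψ, hψ, hu⟩ := CompactSpace.tendsto_subseq (fun k => w (ns (φ k)))
  refine ⟨φ ∘ ψ, ?_⟩
  set σ : ℕ → ℕ := fun k => ns (φ (ψ k)) with hσ
  have hσm : StrictMono σ := hφ.comp hψ
  set w' : ℕ → U := fun n => if n ∈ Set.range σ then w n else u with hw'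
  have hw'lim : Tendsto w' atTop (𝓝 u) := by
    intro V hV
    obtain ⟨K, hK⟩ := eventually_atTop.1 (hu hV)
    refine mem_atTop_sets.2 ⟨σ K, fun n hn => ?_⟩
    change w' n ∈ V
    by_cases hmem : n ∈ Set.range σ
    · obtain ⟨k, rfl⟩ := hmem
      rw [hw']
      simp only [Set.mem_range_self, if_true]
      exact hK k (hσm.le_iff_le.1 hn)
    · rw [hw']
      simp only [hmem, if_false]
      exact mem_of_mem_nhds hV
  refine ((hF w' u hw'lim).comp hσm.tendsto_atTop).congr fun k => ?_
  simp [hw', hσ]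

variable {X U : Type*} [MeasurableSpace X] [MeasurableSpace U]

/-- Uniformly bounded sequences of measurable functions that converge to `0` pointwise. -/
structure IsNull (f : ℕ → X → ℝ) : Prop where
  meas : ∀ n, Measurable (f n)
  bdd : ∃ C : ℝ, ∀ n x, |f n x| ≤ C
  lim : ∀ x, Tendsto (fun n => f n x) atTop (𝓝 0)

theorem IsNull.isBM {f : ℕ → X → ℝ} (hf : IsNull f) (n : ℕ) : IsBM (f n) :=
  ⟨hf.meas n, hf.bdd.imp fun _ h => h n⟩

theorem IsNull.zero : IsNull (fun _ (_ : X) => (0 : ℝ)) :=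
  ⟨fun _ => measurable_const, ⟨0, fun _ _ => by simp⟩, fun _ => tendsto_const_nhds⟩

theorem IsNull.of_real {r : ℕ → ℝ} (hr : Tendsto r atTop (𝓝 0)) : IsNull (fun n (_ : X) => r n) := by
  obtain ⟨C, hC⟩ := (Metric.isBounded_range_of_tendsto r hr).exists_norm_le
  exact ⟨fun _ => measurable_const, ⟨C, fun n _ => hC _ ⟨n, rfl⟩⟩, fun _ => hr⟩

theorem IsNull.add {f g : ℕ → X → ℝ} (hf : IsNull f) (hg : IsNull g) :
    IsNull (fun n x => f n x + g n x) := by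
  obtain ⟨C, hC⟩ := hf.bdd
  obtain ⟨D, hD⟩ := hg.bdd
  exact ⟨fun n => (hf.meas n).add (hg.meas n),
    ⟨C + D, fun n x => (abs_add_le _ _).trans (add_le_add (hC n x) (hD n x))⟩,
    fun x => by simpa using (hf.lim x).add (hg.lim x)⟩

theorem IsNull.abs {f : ℕ → X → ℝ} (hf : IsNull f) : IsNull (fun n x => |f n x|) := by
  obtain ⟨C, hC⟩ := hf.bdd
  exact ⟨fun n => (hf.meas n).abs, ⟨C, fun n x => by rw [abs_abs]; exact hC n x⟩,
    fun x => by simpa using (hf.lim x).abs⟩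

theorem IsNull.const_mul {f : ℕ → X → ℝ} (r : ℝ) (hf : IsNull f) :
    IsNull (fun n x => r * f n x) := by
  obtain ⟨C, hC⟩ := hf.bdd
  refine ⟨fun n => (hf.meas n).const_mul r, ⟨|r| * C, fun n x => ?_⟩,
    fun x => by simpa using (hf.lim x).const_mul r⟩
  rw [abs_mul]
  exact mul_le_mul_of_nonneg_left (hC n x) (abs_nonneg r)

/-- Dominated convergence along a setwise convergent sequence of probability measures. -/
theorem SetwiseTendsto.tendsto_integral_of_isNull {μ : ℕ → Measure X} {ν : Measure X}
    [∀ n, IsProbabilityMeasure (μ n)] [IsProbabilityMeasure ν] (hμ : SetwiseTendsto μ ν)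
    {f : ℕ → X → ℝ} (hf : IsNull f) :
    Tendsto (fun n => ∫ x, f n x ∂(μ n)) atTop (𝓝 0) := by
  obtain ⟨C, hC⟩ := hf.bdd
  -- Setwise convergence tests only fixed functions, so `f n` is dominated for all `n ≥ m` by the
  -- tail envelope `G m`, whose `ν`-integral tends to `0`.
  set G : ℕ → X → ℝ := fun m x => ⨆ k, |f (m + k) x| with hG
  have hb (m : ℕ) (x : X) : BddAbove (Set.range fun k => |f (m + k) x|) :=
    ⟨C, by rintro _ ⟨k, rfl⟩; exact hC _ _⟩
  have hfG {m n : ℕ} (hmn : m ≤ n) (x : X) : |f n x| ≤ G m x := by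
    obtain ⟨k, rfl⟩ := Nat.exists_eq_add_of_le hmn
    exact le_ciSup (hb m x) k
  have hG0 (m : ℕ) (x : X) : 0 ≤ G m x := (abs_nonneg _).trans (hfG le_rfl x)
  have hGC (m : ℕ) (x : X) : |G m x| ≤ C := by
    rw [abs_of_nonneg (hG0 m x)]
    exact ciSup_le fun k => hC _ _
  have hGm (m : ℕ) : Measurable (G m) := Measurable.iSup fun k => (hf.meas _).abs
  have hGlim (x : X) : Tendsto (fun m => G m x) atTop (𝓝 0) := by
    rw [Metric.tendsto_atTop]
    intro ε hε
    obtain ⟨N, hN⟩ := Metric.tendsto_atTop.1 (hf.lim x) (ε / 2) (by positivity)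
    refine ⟨N, fun m hm => ?_⟩
    rw [Real.dist_eq, sub_zero, abs_of_nonneg (hG0 m x)]
    have : G m x ≤ ε / 2 := ciSup_le fun k => by
      simpa [Real.dist_eq] using (hN (m + k) (by omega)).le
    linarith
  have hGint : Tendsto (fun m => ∫ x, G m x ∂ν) atTop (𝓝 0) := by
    have := tendsto_integral_of_dominated_convergence (μ := ν) (F := G) (f := fun _ => 0)
      (fun _ => C) (fun m => (hGm m).aestronglyMeasurable) (integrable_const C)
      (fun m => Eventually.of_forall fun x => hGC m x) (Eventually.of_forall hGlim)
    simpa using this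
  rw [Metric.tendsto_atTop]
  intro ε hε
  obtain ⟨m, hm⟩ := (hGint.eventually (gt_mem_nhds hε)).exists
  obtain ⟨N, hN⟩ := eventually_atTop.1 ((hμ (G m) (hGm m) ⟨C, hGC m⟩).eventually (gt_mem_nhds hm))
  refine ⟨max m N, fun n hn => ?_⟩
  rw [Real.dist_eq, sub_zero]
  refine (abs_integral_le_integral_abs).trans_lt (lt_of_le_of_lt ?_ (hN n (by omega)))
  exact integral_mono ((hf.isBM n).abs.integrable _) (IsBM.integrable ⟨hGm m, C, hGC m⟩ _)
    fun x => hfG (by omega) x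

variable [TopologicalSpace U] [CompactSpace U] [FirstCountableTopology U]

/-- `S n (· | x, u_n) → T (· | x, u)` setwise whenever `u_n → u`. -/
def SetwiseContConv (S : ℕ → Kernel (X × U) X) (T : Kernel (X × U) X) : Prop :=
  ∀ (x : X) (w : ℕ → U) (u : U), Tendsto w atTop (𝓝 u) →
    SetwiseTendsto (fun n => S n (x, w n)) (T (x, u))

variable {S : ℕ → Kernel (X × U) X} {T : Kernel (X × U) X} [∀ n, IsMarkovKernel (S n)]
  [IsMarkovKernel T]

/-- At a fixed state a policy enters only through one action, so the policies may vary with `n`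
without any regularity in the state. -/
theorem IsNull.op_closedLoop (hS : SetwiseContConv S T) (g : ℕ → StationaryPolicy X U)
    {f : ℕ → X → ℝ} (hf : IsNull f) :
    IsNull (fun n => op (closedLoop (S n) (g n)) (f n)) := by
  refine ⟨fun n => ((hf.isBM n).op _).meas, ?_, fun x => ?_⟩
  · obtain ⟨C, hC⟩ := hf.bdd
    exact ⟨C, fun n => abs_op_le _ (hf.isBM n) (hC n)⟩
  · exact tendsto_zero_of_continuous_convergence (F := fun n u => ∫ y, f n y ∂(S n (x, u)))
      (fun w u hw => (hS x w u hw).tendsto_integral_of_isNull hf) (fun n => (g n).act x)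

theorem IsNull.op_stepKernel (hS : SetwiseContConv S T) (g : ℕ → StationaryPolicy X U)
    {f : ℕ → X → ℝ} (hf : IsNull f) (k : ℕ) :
    IsNull (fun n => op (stepKernel (S n) (g n) k) (f n)) := by
  induction k with
  | zero => simpa only [funext (op_stepKernel_zero _ _ (hf.isBM _))] using hf
  | succ k ih =>
    simpa only [funext (op_stepKernel_succ' _ _ (hf.isBM _) k)] using ih.op_closedLoop hS g

theorem SetwiseContConv.isNull_sub (hS : SetwiseContConv S T) (hT : SetwiseContConv (fun _ => T) T)
    (g : ℕ → StationaryPolicy X U) {h : X → ℝ} (hh : IsBM h) :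
    IsNull (fun n x => |op (closedLoop (S n) (g n)) h x - op (closedLoop T (g n)) h x|) := by
  refine ⟨fun n => ((hh.op _).sub (hh.op _)).abs.meas, ?_, fun x => ?_⟩
  · obtain ⟨C, hC⟩ := hh.bdd
    refine ⟨C + C, fun n x => ?_⟩
    rw [abs_abs]
    exact (abs_sub _ _).trans (add_le_add (abs_op_le _ hh hC x) (abs_op_le _ hh hC x))
  · refine tendsto_zero_of_continuous_convergence
      (F := fun n u => |∫ y, h y ∂(S n (x, u)) - ∫ y, h y ∂(T (x, u))|)
      (fun w u hw => ?_) (fun n => (g n).act x)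
    simpa using ((hS x w u hw h hh.meas hh.bdd).sub (hT x w u hw h hh.meas hh.bdd)).abs

end NullSequences

/-! ### Asymptotic constancy of almost sub- and superharmonic sequences. -/

section Merging

variable {X U : Type*} [MeasurableSpace X] [MeasurableSpace U]

theorem IsBM.truncate {f : X → ℝ} (hf : IsBM f) (a : ℝ) {w : ℝ} (hw : 0 ≤ w) :
    IsBM (fun x => min w (max 0 (a - f x))) :=
  ⟨measurable_const.min (measurable_const.max (measurable_const.sub hf.meas)), w, fun x => by
    rw [abs_of_nonneg (le_min hw (le_max_left _ _))]; exact min_le_left _ _⟩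

/-- If the policy `q` follows `g` wherever `a - f ≤ w / 2`, then the truncated defect
`min w (a - f)⁺` grows at most by the factor `3` under `q`, up to error terms. -/
theorem op_truncate_le (S : Kernel (X × U) X) [IsMarkovKernel S] (g q : StationaryPolicy X U)
    {f ρ s : X → ℝ} (hf : IsBM f) (hρ : IsBM ρ) {a w : ℝ} (hw : 0 ≤ w) (hρ0 : ∀ y, 0 ≤ ρ y)
    (hs0 : ∀ y, 0 ≤ s y) (hfρ : ∀ y, f y ≤ a + ρ y)
    (hfs : ∀ y, f y ≤ op (closedLoop S g) f y + s y)
    (hq : ∀ y, (q.act y = g.act y ∧ a - f y ≤ w) ∨ w / 2 ≤ a - f y ∨ w = 0) (y : X) :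
    op (closedLoop S q) (fun y => min w (max 0 (a - f y))) y
      ≤ 3 * min w (max 0 (a - f y)) + s y + op (closedLoop S g) ρ y := by
  have hψ := hf.truncate a hw
  have hψ0 : 0 ≤ min w (max 0 (a - f y)) := le_min hw (le_max_left _ _)
  have hle : op (closedLoop S q) (fun y => min w (max 0 (a - f y))) y ≤ w :=
    op_le _ hψ (fun _ => min_le_left _ _) y
  have hAρ := le_op (closedLoop S g) hρ hρ0 y
  have hsy := hs0 y
  -- Where `q` follows `g`, near-subharmonicity of `f` controls the defect. Where the defect is
  -- already at least `w / 2`, the trivial bound `w` is at most twice the defect. If `w = 0`, the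
  -- truncation vanishes.
  rcases hq y with ⟨h1, h2⟩ | h | h
  · have e : op (closedLoop S q) (fun y => min w (max 0 (a - f y))) y
        = op (closedLoop S g) (fun y => min w (max 0 (a - f y))) y := by
      rw [op_closedLoop, op_closedLoop, h1]
    have h3 := op_mono (closedLoop S g) hψ (((IsBM.const a).sub hf).add hρ) (fun z =>
      (min_le_right _ _).trans (max_le (by linarith [hfρ z]) (by linarith [hρ0 z]))) y
    rw [op_add _ ((IsBM.const a).sub hf) hρ, op_sub _ (IsBM.const a) hf, op_const] at h3
    have h4 : a - f y ≤ min w (max 0 (a - f y)) := le_min h2 (le_max_right _ _)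
    rw [e]
    linarith [hfs y]
  · have : w / 2 ≤ min w (max 0 (a - f y)) := le_min (by linarith) (h.trans (le_max_right _ _))
    linarith
  · linarith

variable [TopologicalSpace U] [CompactSpace U] [FirstCountableTopology U]
  {S : ℕ → Kernel (X × U) X} {T : Kernel (X × U) X} [∀ n, IsMarkovKernel (S n)]
  [IsMarkovKernel T]

theorem exists_isNull_le_op_stepKernel (hS : SetwiseContConv S T) (g : ℕ → StationaryPolicy X U)
    {f e : ℕ → X → ℝ} (hf : ∀ n, IsBM (f n)) (he : IsNull e) {κ : ℕ → ℝ}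
    (hfe : ∀ n x, f n x ≤ op (closedLoop (S n) (g n)) (f n) x + κ n + e n x) (N : ℕ) :
    ∃ r : ℕ → X → ℝ, IsNull r ∧ ∀ n x,
      f n x ≤ op (stepKernel (S n) (g n) N) (f n) x + N * κ n + r n x := by
  induction N with
  | zero => exact ⟨_, IsNull.zero, fun n x => by simp [op_stepKernel_zero _ _ (hf n)]⟩
  | succ N ih =>
    obtain ⟨r, hr, h⟩ := ih
    refine ⟨_, he.add (hr.op_closedLoop hS g), fun n x => ?_⟩
    have h1 := op_mono (closedLoop (S n) (g n)) (hf n)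
      ((((hf n).op _).add (IsBM.const _)).add (hr.isBM n)) (h n) x
    rw [op_add _ (((hf n).op _).add (IsBM.const _)) (hr.isBM n),
      op_add _ ((hf n).op _) (IsBM.const _), op_const, ← op_stepKernel_succ' _ _ (hf n)] at h1
    push_cast
    linarith [hfe n x]

theorem exists_isNull_op_stepKernel_le (hS : SetwiseContConv S T) (q : ℕ → StationaryPolicy X U)
    {ψ e : ℕ → X → ℝ} (hψ : ∀ n, IsBM (ψ n)) (he : IsNull e) {κ : ℝ} (hκ : 0 ≤ κ)
    (hψe : ∀ n x, op (closedLoop (S n) (q n)) (ψ n) x ≤ 3 * ψ n x + κ + e n x) (k : ℕ) :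
    ∃ r : ℕ → X → ℝ, IsNull r ∧ ∀ n x,
      op (stepKernel (S n) (q n) k) (ψ n) x ≤ 3 ^ k * ψ n x + 3 ^ k * κ + r n x := by
  induction k with
  | zero => exact ⟨_, IsNull.zero, fun n x => by simp [op_stepKernel_zero _ _ (hψ n), hκ]⟩
  | succ k ih =>
    obtain ⟨r, hr, h⟩ := ih
    refine ⟨_, (he.const_mul (3 ^ k)).add (hr.op_closedLoop hS q), fun n x => ?_⟩
    have h1 := op_mono (closedLoop (S n) (q n)) ((hψ n).op _)
      ((((hψ n).const_mul _).add (IsBM.const _)).add (hr.isBM n)) (h n) x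
    rw [op_add _ (((hψ n).const_mul _).add (IsBM.const _)) (hr.isBM n),
      op_add _ ((hψ n).const_mul _) (IsBM.const _), op_const, op_const_mul,
      ← op_stepKernel_succ' _ _ (hψ n)] at h1
    have h2 := mul_le_mul_of_nonneg_left (hψe n x) (show (0 : ℝ) ≤ 3 ^ k by positivity)
    have h3 : (0 : ℝ) ≤ 3 ^ k * κ := by positivity
    rw [pow_succ]
    linarith

/-- As `a n` is both an almost upper bound of `f n` and its mean after `N` steps from `x`, the
expected defect at time `N` is at most `η` plus a null term. Each of the `t` further steps under `q`
costs at most the factor `3` of `op_truncate_le`. -/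
theorem exists_tendsto_zero_op_truncate_le (hS : SetwiseContConv S T)
    (g q : ℕ → StationaryPolicy X U) {f r e : ℕ → X → ℝ} (hf : ∀ n, IsBM (f n)) (hr : IsNull r)
    (he : IsNull e) (hr0 : ∀ n x, 0 ≤ r n x) (he0 : ∀ n x, 0 ≤ e n x) {a w : ℕ → ℝ}
    (hw : ∀ n, 0 ≤ w n) {η κ : ℝ} (hη : 0 ≤ η) (hκ : 0 ≤ κ)
    (hfr : ∀ n y, f n y ≤ a n + (η + r n y))
    (hfe : ∀ n y, f n y ≤ op (closedLoop (S n) (g n)) (f n) y + κ + e n y)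
    (hq : ∀ n y, ((q n).act y = (g n).act y ∧ a n - f n y ≤ w n) ∨
      w n / 2 ≤ a n - f n y ∨ w n = 0)
    (x : X) (N t : ℕ) (ha : ∀ n, a n = op (stepKernel (S n) (g n) N) (f n) x) :
    ∃ z : ℕ → ℝ, Tendsto z atTop (𝓝 0) ∧ ∀ n,
      op (stepKernel (S n) (g n) N) (op (stepKernel (S n) (q n) t)
        (fun y => min (w n) (max 0 (a n - f n y)))) x ≤ 2 * 3 ^ t * η + 3 ^ t * κ + z n := by
  have hψ (n : ℕ) := (hf n).truncate (a n) (hw n)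
  have h1 (n : ℕ) (y : X) : op (closedLoop (S n) (q n)) (fun y => min (w n) (max 0 (a n - f n y))) y
      ≤ 3 * min (w n) (max 0 (a n - f n y)) + (κ + η)
        + (e n y + op (closedLoop (S n) (g n)) (r n) y) := by
    have := op_truncate_le (S n) (g n) (q n) (s := fun y => κ + e n y) (hf n)
      ((IsBM.const η).add (hr.isBM n)) (hw n) (fun y => add_nonneg hη (hr0 n y))
      (fun y => add_nonneg hκ (he0 n y)) (hfr n) (fun y => by linarith [hfe n y]) (hq n) y
    rw [op_add _ (IsBM.const η) (hr.isBM n), op_const] at this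
    linarith
  obtain ⟨r', hr', h2⟩ := exists_isNull_op_stepKernel_le hS q hψ
    (he.add (hr.op_closedLoop hS g)) (add_nonneg hκ hη) h1 t
  refine ⟨_, ((((hr.op_stepKernel hS g N).const_mul (3 ^ t)).add
    (hr'.op_stepKernel hS g N)).lim x), fun n => ?_⟩
  have h3 := op_mono (stepKernel (S n) (g n) N) ((hψ n).op _)
    ((((hψ n).const_mul _).add (IsBM.const _)).add (hr'.isBM n)) (h2 n) x
  rw [op_add _ (((hψ n).const_mul _).add (IsBM.const _)) (hr'.isBM n),
    op_add _ ((hψ n).const_mul _) (IsBM.const _), op_const, op_const_mul] at h3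
  have h4 := op_mono (stepKernel (S n) (g n) N) (hψ n)
    (((IsBM.const (a n)).sub (hf n)).add ((IsBM.const η).add (hr.isBM n))) (fun y =>
      (min_le_right _ _).trans (max_le (by linarith [hfr n y]) (by linarith [hr0 n y]))) x
  rw [op_add _ ((IsBM.const (a n)).sub (hf n)) ((IsBM.const η).add (hr.isBM n)),
    op_sub _ (IsBM.const _) (hf n), op_const, op_add _ (IsBM.const η) (hr.isBM n), op_const,
    ← ha n] at h4
  have h5 := mul_le_mul_of_nonneg_left h4 (show (0 : ℝ) ≤ 3 ^ t by positivity)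
  linarith

variable {t : ℕ} {β : ℝ}

/-- After `t * p` steps the average hardly depends on the starting state, so the bound at `y` may
use the value at the fixed state `x`. This costs `β ^ p * (2 * F)`, while the drift contributes `t *
p * κ`. -/
theorem exists_isNull_le_add (hS : SetwiseContConv S T)
    (hSe : ∀ n, ErgodicityCondition (S n) t β) (g : ℕ → StationaryPolicy X U) {f e : ℕ → X → ℝ}
    (hf : ∀ n, IsBM (f n)) {F : ℝ} (hF : ∀ n x, |f n x| ≤ F) (he : IsNull e) {κ : ℝ}
    (hfe : ∀ n x, f n x ≤ op (closedLoop (S n) (g n)) (f n) x + κ + e n x) (x : X) (p : ℕ) :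
    ∃ r : ℕ → X → ℝ, IsNull r ∧ (∀ n y, 0 ≤ r n y) ∧ ∀ n y,
      f n y ≤ op (stepKernel (S n) (g n) (t * p)) (f n) x
        + ((β ^ p * (2 * F) + t * p * κ) + r n y) := by
  obtain ⟨r, hr, h⟩ := exists_isNull_le_op_stepKernel hS g hf he hfe (t * p)
  refine ⟨_, hr.abs, fun n y => abs_nonneg _, fun n y => ?_⟩
  have h1 := (hSe n).osc_pow_le (g n) (hf n) (s := 2 * F) (fun x x' => by
    linarith [abs_le.1 (hF n x), abs_le.1 (hF n x')]) p y x
  have h2 := h n y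
  push_cast at h2
  linarith [le_abs_self (r n y)]

/-- A sequence that is asymptotically subharmonic under the policies `g n` and superharmonic under
the policies `g' n` is asymptotically constant: otherwise the policy that follows `g n` where `f n`
is large and `g' n` where it is small would violate the ergodicity condition. -/
theorem exists_isNull_sub_op_le (hS : SetwiseContConv S T)
    (hSe : ∀ n, ErgodicityCondition (S n) t β) (hβ : 0 < β) (hβ1 : β < 1)
    (g g' : ℕ → StationaryPolicy X U)
    {f e : ℕ → X → ℝ} (hf : ∀ n, IsBM (f n)) {F : ℝ} (hF : ∀ n x, |f n x| ≤ F) (he : IsNull e)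
    (he0 : ∀ n x, 0 ≤ e n x) {κ : ℝ} (hκ : 0 ≤ κ)
    (hfe : ∀ n x, f n x ≤ op (closedLoop (S n) (g n)) (f n) x + κ + e n x)
    (hfe' : ∀ n x, op (closedLoop (S n) (g' n)) (f n) x ≤ f n x + κ + e n x) (x : X) (p : ℕ)
    {η : ℝ} (hη : η = β ^ p * (2 * F) + t * p * κ) :
    ∃ ρ : ℕ → X → ℝ, IsNull ρ ∧ ∀ n y,
      f n y - op (closedLoop (S n) (g' n)) (f n) y
        ≤ (4 * 3 ^ t * η + 2 * 3 ^ t * κ) / (1 - β) + 2 * η + ρ n y := by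
  classical
  have hF0 : 0 ≤ F := (abs_nonneg _).trans (hF 0 x)
  have hη0 : 0 ≤ η := by rw [hη]; positivity
  have hnf (n : ℕ) : IsBM (fun y => - f n y) := (hf n).neg
  have hnfe (n : ℕ) (y : X) :
      - f n y ≤ op (closedLoop (S n) (g' n)) (fun y => - f n y) y + κ + e n y := by
    rw [op_neg]; linarith [hfe' n y]
  obtain ⟨r, hr, hr0, h1⟩ := exists_isNull_le_add hS hSe g hf hF he hfe x p
  obtain ⟨r', hr', hr0', h1'⟩ := exists_isNull_le_add hS hSe g' hnf
    (fun n y => by rw [abs_neg]; exact hF n y) he hnfe x p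
  rw [← hη] at h1 h1'
  set N := t * p
  set a : ℕ → ℝ := fun n => op (stepKernel (S n) (g n) N) (f n) x with ha
  set b : ℕ → ℝ := fun n => op (stepKernel (S n) (g' n) N) (f n) x with hb
  set w : ℕ → ℝ := fun n => max (a n - b n) 0 with hw
  have hw0 (n : ℕ) : 0 ≤ w n := le_max_right _ _
  -- The switching policy: `g` in the upper half of the gap between `b n` and `a n`, `g'` in the
  -- lower half.
  set q : ℕ → StationaryPolicy X U := fun n =>
    { act := fun y => if a n - f n y ≤ w n / 2 then (g n).act y else (g' n).act y
      measurable_act := Measurable.ite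
        (measurableSet_le (measurable_const.sub (hf n).meas) measurable_const)
        (g n).measurable_act (g' n).measurable_act } with hq
  obtain ⟨z, hz, h2⟩ := exists_tendsto_zero_op_truncate_le hS g q hf hr he hr0 he0 hw0 hη0 hκ h1 hfe
    (fun n y => by
      by_cases h : a n - f n y ≤ w n / 2
      · exact Or.inl ⟨if_pos h, by linarith [hw0 n]⟩
      · exact Or.inr (Or.inl (not_le.1 h).le)) x N t (fun n => rfl)
  obtain ⟨z', hz', h2'⟩ := exists_tendsto_zero_op_truncate_le hS g' q (a := fun n => - b n) hnf hr'
    he hr0' he0 hw0 hη0 hκ (fun n y => by have := h1' n y; rwa [op_neg] at this) hnfe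
    (fun n y => by
      rcases le_total (a n) (b n) with hab | hab
      · exact Or.inr (Or.inr (max_eq_right (by linarith)))
      · have hwn : w n = a n - b n := max_eq_left (by linarith)
        by_cases h : a n - f n y ≤ w n / 2
        · exact Or.inr (Or.inl (by linarith))
        · exact Or.inl ⟨if_neg h, by linarith⟩) x N t (fun n => (op_neg _ _ _).symm)
  have hgap (n : ℕ) : w n ≤ (4 * 3 ^ t * η + 2 * 3 ^ t * κ) / (1 - β) + (z n + z' n) / (1 - β) := by
    rw [← add_div, le_div_iff₀ (by linarith)]
    have hψ := (hf n).truncate (a n) (hw0 n)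
    -- The truncated defects from the two levels add up to `w n`, so one function measures both.
    have e1 : (fun y => min (w n) (max 0 (- b n - - f n y)))
        = fun y => w n - min (w n) (max 0 (a n - f n y)) := by
      funext y
      rcases le_total (a n) (b n) with hab | hab
      · have hwn : w n = 0 := max_eq_right (by linarith)
        rw [hwn, min_eq_left (le_max_left _ _), min_eq_left (le_max_left _ _), sub_zero]
      · have hwn : w n = a n - b n := max_eq_left (by linarith)
        rw [hwn]
        rcases le_total (a n - f n y) 0 with h | h <;>
        rcases le_total (f n y - b n) 0 with h' | h' <;>
        simp only [min_def, max_def] <;> split_ifs <;> linarith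
    have h3 := h2 n
    have h3' := h2' n
    rw [e1] at h3'
    set G := op (stepKernel (S n) (q n) t) (fun y => min (w n) (max 0 (a n - f n y))) with hG
    have e2 : op (stepKernel (S n) (q n) t) (fun y => w n - min (w n) (max 0 (a n - f n y)))
        = fun y => w n - G y := by
      funext y
      rw [op_sub _ (IsBM.const _) hψ, op_const]
    have hGm : IsBM G := hψ.op _
    rw [e2, op_sub _ (IsBM.const _) hGm, op_const] at h3'
    -- The two defect bounds put the averages of `G` from the two starting laws almost `w n` apart,
    -- but ergodicity of `q` limits the oscillation of `G` to `β * w n`.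
    have h4 := op_sub_op_le_of_osc (stepKernel (S n) (g' n) N) (stepKernel (S n) (g n) N) hGm
      ((hSe n).osc_le (q n) hψ (s := w n) (fun y y' => by
        have := min_le_left (w n) (max 0 (a n - f n y))
        have : 0 ≤ min (w n) (max 0 (a n - f n y')) := le_min (hw0 n) (le_max_left _ _)
        linarith)) x x
    linarith
  refine ⟨_, ((IsNull.of_real (by simpa using (hz.add hz').div_const (1 - β))).add hr).add
    (hr'.op_closedLoop hS g'), fun n y => ?_⟩
  have h5 := op_mono (closedLoop (S n) (g' n)) (hnf n)
    ((IsBM.const (- b n)).add ((IsBM.const η).add (hr'.isBM n)))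
    (fun y => by have := h1' n y; rwa [op_neg] at this) y
  rw [op_add _ (IsBM.const _) ((IsBM.const η).add (hr'.isBM n)),
    op_add _ (IsBM.const η) (hr'.isBM n), op_const, op_const, op_neg] at h5
  linarith [hgap n, h1 n y, le_max_left (a n - b n) 0]

end Merging

/-! ### Total and average costs through Poisson inequalities. -/

section Costs

variable {X U : Type*} [MeasurableSpace X] [MeasurableSpace U]

theorem measurable_snoc {Ω Y : Type*} [MeasurableSpace Ω] [MeasurableSpace Y] {k : ℕ}
    {f : Ω → Fin k → Y} {g : Ω → Y} (hf : Measurable f) (hg : Measurable g) :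
    Measurable (fun ω => (Fin.snoc (α := fun _ => Y) (f ω) (g ω) : Fin (k + 1) → Y)) := by
  refine measurable_pi_iff.2 fun i => ?_
  induction i using Fin.lastCases with
  | last => simpa using hg
  | cast i => simpa using measurable_pi_iff.1 hf i

theorem AdmissiblePolicy.measurable_snoc (γ : AdmissiblePolicy X U) (t : ℕ) :
    Measurable (fun p : History X U t × X =>
      ((Fin.snoc (α := fun _ => X) p.1.1 p.2, Fin.snoc (α := fun _ => U) p.1.2 (γ.act t p.1)) :
        History X U (t + 1))) :=
  (AvgMDP.measurable_snoc (measurable_fst.comp measurable_fst) measurable_snd).prodMk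
    (AvgMDP.measurable_snoc (measurable_snd.comp measurable_fst)
      ((γ.measurable_act t).comp measurable_fst))

instance (T : Kernel (X × U) X) [IsMarkovKernel T] (γ : AdmissiblePolicy X U) (t : ℕ) :
    IsMarkovKernel (nextState T γ t) := by
  unfold nextState; infer_instance

instance (T : Kernel (X × U) X) [IsMarkovKernel T] (γ : AdmissiblePolicy X U) (x : X) (t : ℕ) :
    IsProbabilityMeasure (histLaw T γ x t) := by
  induction t with
  | zero => unfold histLaw; infer_instance
  | succ t ih =>
    unfold histLaw
    exact Measure.isProbabilityMeasure_map (γ.measurable_snoc t).aemeasurable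

theorem finiteCost_zero (c : X → U → ℝ) (T : Kernel (X × U) X) (γ : AdmissiblePolicy X U) (x : X) :
    finiteCost c T γ 0 x = 0 := by
  simp [finiteCost]

section

variable (T : Kernel (X × U) X) [IsMarkovKernel T] (γ : AdmissiblePolicy X U) (x : X)

theorem integral_histLaw_succ (t : ℕ) {φ : History X U (t + 1) → ℝ} (hφ : IsBM φ) :
    ∫ h, φ h ∂(histLaw T γ x (t + 1)) = ∫ h, ∫ y, φ (Fin.snoc (α := fun _ => X) h.1 y,
      Fin.snoc (α := fun _ => U) h.2 (γ.act t h)) ∂(T (h.1 (Fin.last t), γ.act t h))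
        ∂(histLaw T γ x t) := by
  have hm := γ.measurable_snoc t
  have hφm : IsBM (fun p : History X U t × X => φ (Fin.snoc (α := fun _ => X) p.1.1 p.2,
      Fin.snoc (α := fun _ => U) p.1.2 (γ.act t p.1))) :=
    ⟨hφ.meas.comp hm, hφ.bdd.imp fun _ h _ => h _⟩
  rw [histLaw, integral_map hm.aemeasurable hφ.meas.aestronglyMeasurable,
    Measure.integral_compProd (hφm.integrable _)]
  rfl

theorem integral_last_histLaw_succ (t : ℕ) {φ : X → ℝ} (hφ : IsBM φ) :
    ∫ h, φ (h.1 (Fin.last (t + 1))) ∂(histLaw T γ x (t + 1))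
      = ∫ h, ∫ y, φ y ∂(T (h.1 (Fin.last t), γ.act t h)) ∂(histLaw T γ x t) := by
  rw [integral_histLaw_succ T γ x t (φ := fun h => φ (h.1 (Fin.last (t + 1))))
    ⟨hφ.meas.comp ((measurable_pi_apply _).comp measurable_fst), hφ.bdd.imp fun _ h _ => h _⟩]
  simp

variable {c : X → U → ℝ} (hc : IsBM (Function.uncurry c))

include hc in
theorem isBM_stageCost (t : ℕ) :
    IsBM (fun h : History X U t => c (h.1 (Fin.last t)) (γ.act t h)) :=
  ⟨hc.meas.comp (((measurable_pi_apply _).comp measurable_fst).prodMk (γ.measurable_act t)),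
    hc.bdd.imp fun _ h _ => h (_, _)⟩

include hc in
theorem isBM_totalCost (t : ℕ) :
    IsBM (fun h : History X U t => ∑ i : Fin t, c (h.1 i.castSucc) (h.2 i)) := by
  obtain ⟨K, hK⟩ := hc.bdd
  have hm (i : Fin t) : Measurable fun h : History X U t => (h.1 i.castSucc, h.2 i) :=
    ((measurable_pi_apply _).comp measurable_fst).prodMk
      ((measurable_pi_apply _).comp measurable_snd)
  refine ⟨Finset.measurable_sum _ fun i _ => hc.meas.comp (hm i), ∑ _i : Fin t, K, fun h => ?_⟩
  exact (Finset.abs_sum_le_sum_abs _ _).trans (Finset.sum_le_sum fun i _ => hK (_, _))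

include hc in
theorem finiteCost_succ (N : ℕ) :
    finiteCost c T γ (N + 1) x
      = finiteCost c T γ N x + ∫ h, c (h.1 (Fin.last N)) (γ.act N h) ∂(histLaw T γ x N) := by
  rw [finiteCost, integral_histLaw_succ T γ x N (isBM_totalCost hc (N + 1)), finiteCost,
    ← integral_add ((isBM_totalCost hc N).integrable _) ((isBM_stageCost γ hc N).integrable _)]
  refine integral_congr_ae (Eventually.of_forall fun h => ?_)
  simp only [Fin.sum_univ_castSucc, Fin.snoc_castSucc, Fin.snoc_last]
  simp

-- Verification argument: the inequality holds for every action, so it can be integrated along the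
-- history law of any admissible policy and telescopes.
include hc in
theorem le_finiteCost_add {h : X → ℝ} (hh : IsBM h) {j : ℝ}
    (hj : ∀ x u, h x + j ≤ c x u + ∫ y, h y ∂(T (x, u))) (N : ℕ) :
    N * j + h x ≤ finiteCost c T γ N x + ∫ ω, h (ω.1 (Fin.last N)) ∂(histLaw T γ x N) := by
  induction N with
  | zero =>
    have hm : StronglyMeasurable (fun ω : History X U 0 => h (ω.1 (Fin.last 0))) :=
      (hh.meas.comp ((measurable_pi_apply _).comp measurable_fst)).stronglyMeasurable
    rw [finiteCost_zero, histLaw, integral_dirac' _ _ hm]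
    simp
  | succ N ih =>
    rw [finiteCost_succ T γ x hc, integral_last_histLaw_succ T γ x N hh]
    have h1 : IsBM (fun ω : History X U N => h (ω.1 (Fin.last N))) :=
      ⟨hh.meas.comp ((measurable_pi_apply _).comp measurable_fst), hh.bdd.imp fun _ h _ => h _⟩
    have h2 : IsBM (fun ω : History X U N => ∫ y, h y ∂(T (ω.1 (Fin.last N), γ.act N ω))) := by
      refine ⟨?_, ?_⟩
      · exact (hh.meas.stronglyMeasurable.integral_kernel (κ := nextState T γ N)).measurable
      · obtain ⟨C, hC⟩ := hh.bdd
        refine ⟨C, fun ω => ?_⟩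
        have := norm_integral_le_of_norm_le_const (μ := T (ω.1 (Fin.last N), γ.act N ω)) (f := h)
          (Eventually.of_forall hC)
        simpa using this
    have h3 := isBM_stageCost γ hc N
    have h4 : ∫ ω, (h (ω.1 (Fin.last N)) + j) ∂(histLaw T γ x N)
        ≤ ∫ ω, (c (ω.1 (Fin.last N)) (γ.act N ω)
          + ∫ y, h y ∂(T (ω.1 (Fin.last N), γ.act N ω))) ∂(histLaw T γ x N) :=
      integral_mono ((h1.add (IsBM.const j)).integrable _) ((h3.add h2).integrable _)
        fun ω => hj _ _
    rw [integral_add (h1.integrable _) (integrable_const j),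
      integral_add (h3.integrable _) (h2.integrable _), integral_const, probReal_univ,
      one_smul] at h4
    push_cast
    linarith

theorem abs_finiteCost_le {c : X → U → ℝ} {K : ℝ} (hK : ∀ x u, |c x u| ≤ K) (N : ℕ) :
    |finiteCost c T γ N x| ≤ N * K := by
  have := norm_integral_le_of_norm_le_const (μ := histLaw T γ x N)
    (f := fun h => ∑ t : Fin N, c (h.1 t.castSucc) (h.2 t)) (C := N * K)
    (Eventually.of_forall fun h => by
      refine (Finset.abs_sum_le_sum_abs _ _).trans ?_
      refine (Finset.sum_le_sum fun i _ => hK _ _).trans ?_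
      simp)
  simpa [finiteCost] using this

end

theorem op_stepKernel_eq_integral_histLaw (T : Kernel (X × U) X) [IsMarkovKernel T]
    (g : StationaryPolicy X U) (x : X) (N : ℕ) {φ : X → ℝ} (hφ : IsBM φ) :
    ∫ h, φ (h.1 (Fin.last N)) ∂(histLaw T g.toAdmissible x N) = op (stepKernel T g N) φ x := by
  induction N generalizing φ with
  | zero =>
    have hm : StronglyMeasurable (fun ω : History X U 0 => φ (ω.1 (Fin.last 0))) :=
      (hφ.meas.comp ((measurable_pi_apply _).comp measurable_fst)).stronglyMeasurable
    rw [op_stepKernel_zero T g hφ, histLaw, integral_dirac' _ _ hm]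
  | succ N ih =>
    rw [integral_last_histLaw_succ T _ x N hφ, op_stepKernel_succ T g hφ, ← ih (hφ.op _)]
    rfl

variable {c : X → U → ℝ} (hc : IsBM (Function.uncurry c))

include hc in
theorem isBM_closedLoopCost (g : StationaryPolicy X U) : IsBM (fun x => c x (g.act x)) :=
  ⟨hc.meas.comp (measurable_id.prodMk g.measurable_act), hc.bdd.imp fun _ h _ => h (_, _)⟩

include hc in
theorem finiteCost_stationary (T : Kernel (X × U) X) [IsMarkovKernel T]
    (g : StationaryPolicy X U) (x : X) (N : ℕ) :
    finiteCost c T g.toAdmissible N x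
      = ∑ k ∈ Finset.range N, op (stepKernel T g k) (fun x => c x (g.act x)) x := by
  induction N with
  | zero => simp [finiteCost_zero]
  | succ N ih =>
    rw [finiteCost_succ T _ x hc, ih, Finset.sum_range_succ,
      ← op_stepKernel_eq_integral_histLaw T g x N (isBM_closedLoopCost hc g)]
    rfl

include hc in
/-- The total cost of a stationary policy with an excess `D` in a Poisson inequality. -/
theorem finiteCost_stationary_add_le (T : Kernel (X × U) X) [IsMarkovKernel T]
    (g : StationaryPolicy X U) {h D : X → ℝ} (hh : IsBM h) (hD : IsBM D) {j : ℝ}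
    (hj : ∀ x, c x (g.act x) + op (closedLoop T g) h x ≤ h x + j + D x) (x : X) (N : ℕ) :
    finiteCost c T g.toAdmissible N x + op (stepKernel T g N) h x
      ≤ h x + N * j + ∑ k ∈ Finset.range N, op (stepKernel T g k) D x := by
  rw [finiteCost_stationary hc]
  induction N with
  | zero => simp [op_stepKernel_zero T g hh]
  | succ N ih =>
    have hcg := isBM_closedLoopCost hc g
    have h1 := op_mono (stepKernel T g N) (hcg.add (hh.op (closedLoop T g)))
      ((hh.add (IsBM.const j)).add hD) hj x
    rw [op_add _ hcg (hh.op _), op_add _ (hh.add (IsBM.const j)) hD, op_add _ hh (IsBM.const j),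
      op_const, ← op_stepKernel_succ T g hh] at h1
    rw [Finset.sum_range_succ, Finset.sum_range_succ]
    push_cast
    linarith

section

variable (T : Kernel (X × U) X) [IsMarkovKernel T] (γ : AdmissiblePolicy X U) (x : X)

-- Real-valued `limsup` is meaningful only for bounded sequences. At `N = 0` the average is `0`, by
-- the convention `1 / 0 = 0`.
include hc in
theorem exists_abs_avg_le : ∃ K : ℝ, ∀ (γ : AdmissiblePolicy X U) (N : ℕ),
    |1 / (N : ℝ) * finiteCost c T γ N x| ≤ K := by
  obtain ⟨K, hK⟩ := hc.bdd
  refine ⟨|K|, fun γ N => ?_⟩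
  have := abs_finiteCost_le T γ x (c := c) (K := |K|) (fun x u => (hK (x, u)).trans (le_abs_self K)) N
  rcases N.eq_zero_or_pos with rfl | hN
  · simp
  · have hN' : (0 : ℝ) < N := by exact_mod_cast hN
    rw [abs_mul, abs_of_pos (by positivity), div_mul_eq_mul_div, one_mul, div_le_iff₀ hN']
    linarith

include hc in
theorem le_avgCost {j C : ℝ} (h : ∀ N : ℕ, N * j - C ≤ finiteCost c T γ N x) :
    j ≤ avgCost c T γ x := by
  obtain ⟨K, hK⟩ := exists_abs_avg_le hc T x
  have hlim : Tendsto (fun N : ℕ => j - C / N) atTop (𝓝 j) := by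
    simpa using tendsto_const_nhds.sub (tendsto_const_div_atTop_nhds_zero_nat C)
  rw [avgCost, ← hlim.limsup_eq]
  refine limsup_le_limsup ?_ hlim.isCoboundedUnder_le
    (isBoundedUnder_of ⟨K, fun N => (abs_le.1 (hK γ N)).2⟩)
  filter_upwards [eventually_gt_atTop 0] with N hN
  have hN' : (0 : ℝ) < N := by exact_mod_cast hN
  rw [one_div, inv_mul_eq_div, le_div_iff₀ hN', sub_mul, div_mul_cancel₀ _ hN'.ne']
  linarith [h N]

include hc in
theorem avgCost_le {j C : ℝ} (h : ∀ N : ℕ, finiteCost c T γ N x ≤ N * j + C) :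
    avgCost c T γ x ≤ j := by
  obtain ⟨K, hK⟩ := exists_abs_avg_le hc T x
  have hlim : Tendsto (fun N : ℕ => j + C / N) atTop (𝓝 j) := by
    simpa using tendsto_const_nhds.add (tendsto_const_div_atTop_nhds_zero_nat C)
  rw [avgCost, ← hlim.limsup_eq]
  have hb : IsBoundedUnder (· ≥ ·) atTop fun N : ℕ => 1 / (N : ℝ) * finiteCost c T γ N x :=
    isBoundedUnder_of ⟨-K, fun N => (abs_le.1 (hK γ N)).1⟩
  refine limsup_le_limsup ?_ hb.isCoboundedUnder_le hlim.isBoundedUnder_le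
  filter_upwards [eventually_gt_atTop 0] with N hN
  have hN' : (0 : ℝ) < N := by exact_mod_cast hN
  rw [one_div, inv_mul_eq_div, div_le_iff₀ hN', add_mul, div_mul_cancel₀ _ hN'.ne']
  linarith [h N]

include hc in
theorem neg_le_avgCost {K : ℝ} (hK : ∀ x u, |c x u| ≤ K) : -K ≤ avgCost c T γ x :=
  le_avgCost hc T γ x (C := 0) fun N => by
    linarith [(abs_le.1 (abs_finiteCost_le T γ x hK N)).1]

include hc in
theorem optAvgCost_le : optAvgCost c T x ≤ avgCost c T γ x := by
  obtain ⟨K, hK⟩ := hc.bdd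
  refine ciInf_le ⟨-K, ?_⟩ γ
  rintro _ ⟨γ, rfl⟩
  exact neg_le_avgCost hc T γ x fun x u => hK (x, u)

include hc in
theorem le_optAvgCost [Nonempty (AdmissiblePolicy X U)] {h : X → ℝ} (hh : IsBM h) {j : ℝ}
    (hj : ∀ x u, h x + j ≤ c x u + ∫ y, h y ∂(T (x, u))) : j ≤ optAvgCost c T x := by
  obtain ⟨C, hC⟩ := hh.bdd
  refine le_ciInf fun γ => le_avgCost hc T γ x (C := C + C) fun N => ?_
  have h1 := le_finiteCost_add T γ x hc hh hj N
  have h2 := norm_integral_le_of_norm_le_const (μ := histLaw T γ x N)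
    (f := fun ω => h (ω.1 (Fin.last N))) (Eventually.of_forall fun _ => hC _)
  rw [probReal_univ, mul_one] at h2
  linarith [(abs_le.1 (hC x)).1, (abs_le.1 h2).2]

end

end Costs

/-! ### Approximate solutions of the average cost optimality equation. -/

section ApproximateOptimality

variable {X U : Type*} [MeasurableSpace X] [MeasurableSpace U]

/-- By continuity the infimum can be taken over a countable dense sequence of actions. Choosing the
first `ε`-optimal index then gives a measurable selector. -/
theorem isBM_iInf_and_exists_near_selector [TopologicalSpace U] [TopologicalSpace.SeparableSpace U] [Nonempty U]
    {F : X → U → ℝ} (hFm : ∀ u, Measurable fun x => F x u) (hFc : ∀ x, Continuous (F x)) {C : ℝ}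
    (hC : ∀ x u, |F x u| ≤ C) :
    IsBM (fun x => ⨅ u, F x u) ∧
      ∀ ε > 0, ∃ g : StationaryPolicy X U, ∀ x, F x (g.act x) ≤ (⨅ u, F x u) + ε := by
  classical
  set d := TopologicalSpace.denseSeq U
  have hb (x : X) : BddBelow (Set.range (F x)) :=
    ⟨-C, by rintro _ ⟨u, rfl⟩; exact (abs_le.1 (hC x u)).1⟩
  have hb' (x : X) : BddBelow (Set.range fun n => F x (d n)) :=
    ⟨-C, by rintro _ ⟨u, rfl⟩; exact (abs_le.1 (hC x _)).1⟩
  have he (x : X) : ⨅ u, F x u = ⨅ n, F x (d n) :=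
    le_antisymm (le_ciInf fun n => ciInf_le (hb x) _) (le_ciInf fun u =>
      (TopologicalSpace.denseRange_denseSeq U).induction_on
        (p := fun u => ⨅ n, F x (d n) ≤ F x u) u
        (isClosed_le continuous_const (hFc x)) fun n => ciInf_le (hb' x) n)
  have hm : Measurable fun x => ⨅ u, F x u := by
    simp only [he]
    exact Measurable.iInf fun n => hFm _
  refine ⟨⟨hm, C, fun x => abs_le.2 ⟨le_ciInf fun u => (abs_le.1 (hC x u)).1,
    (ciInf_le (hb x) (Classical.arbitrary U)).trans (abs_le.1 (hC x _)).2⟩⟩, fun ε hε => ?_⟩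
  have hex (x : X) : ∃ n, F x (d n) ≤ (⨅ u, F x u) + ε := by
    obtain ⟨n, hn⟩ := exists_lt_of_ciInf_lt
      (show ⨅ n, F x (d n) < (⨅ u, F x u) + ε by rw [← he]; linarith)
    exact ⟨n, hn.le⟩
  exact ⟨⟨fun x => d (Nat.find (hex x)), (measurable_from_nat (f := d)).comp
    (measurable_find hex fun n => measurableSet_le (hFm _) (hm.add_const ε))⟩,
    fun x => Nat.find_spec (hex x)⟩

theorem isBM_integral {T : Kernel (X × U) X} [IsMarkovKernel T] {f : X → ℝ} (hf : IsBM f) :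
    IsBM (fun p : X × U => ∫ y, f y ∂(T p)) := by
  obtain ⟨C, hC⟩ := hf.bdd
  refine ⟨(hf.meas.stronglyMeasurable.integral_kernel (κ := T)).measurable, C, fun p => ?_⟩
  simpa using norm_integral_le_of_norm_le_const (μ := T p) (f := f) (Eventually.of_forall hC)

variable [TopologicalSpace U] [FirstCountableTopology U]

theorem SetwiseContConv.continuous_integral {T : Kernel (X × U) X}
    (hT : SetwiseContConv (fun _ => T) T) {f : X → ℝ} (hf : IsBM f) (x : X) :
    Continuous fun u => ∫ y, f y ∂(T (x, u)) :=
  continuous_iff_seqContinuous.2 fun w u hw => hT x w u hw f hf.meas hf.bdd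

variable [TopologicalSpace.SeparableSpace U] [Nonempty U] {c : X → U → ℝ} (hc : IsBM (Function.uncurry c))
  (hcc : ∀ x, Continuous (c x)) {T : Kernel (X × U) X} [IsMarkovKernel T]
  (hT : SetwiseContConv (fun _ => T) T)

/-- The Bellman operator with discount factor `α`. -/
noncomputable def bellman (c : X → U → ℝ) (T : Kernel (X × U) X) (α : ℝ) (w : X → ℝ) (x : X) : ℝ :=
  ⨅ u, (c x u + α * ∫ y, w y ∂(T (x, u)))

include hc hcc hT in
theorem isBM_bellman_and_exists_near_selector (α : ℝ) {w : X → ℝ} (hw : IsBM w) :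
    IsBM (bellman c T α w) ∧ ∀ ε > 0, ∃ g : StationaryPolicy X U, ∀ x,
      c x (g.act x) + α * op (closedLoop T g) w x ≤ bellman c T α w x + ε := by
  have h := hc.add ((isBM_integral (T := T) hw).const_mul α)
  obtain ⟨C, hC⟩ := h.bdd
  exact isBM_iInf_and_exists_near_selector
    (F := fun x u => c x u + α * ∫ y, w y ∂(T (x, u)))
    (fun u => h.meas.comp measurable_prodMk_right)
    (fun x => (hcc x).add ((hT.continuous_integral hw x).const_mul α)) (fun x u => hC (x, u))

include hc in
omit [TopologicalSpace U] [FirstCountableTopology U] [TopologicalSpace.SeparableSpace U] [Nonempty U] in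
theorem bellman_le (α : ℝ) {w : X → ℝ} (hw : IsBM w) (x : X) (u : U) :
    bellman c T α w x ≤ c x u + α * ∫ y, w y ∂(T (x, u)) := by
  obtain ⟨C, hC⟩ := (hc.add ((isBM_integral (T := T) hw).const_mul α)).bdd
  refine ciInf_le ⟨-C, ?_⟩ u
  rintro _ ⟨u, rfl⟩
  exact (abs_le.1 (hC (x, u))).1

include hc in
omit [TopologicalSpace U] [FirstCountableTopology U] [TopologicalSpace.SeparableSpace U] in
theorem bellman_sub_le {α : ℝ} (hα : 0 ≤ α) {w w' : X → ℝ} (hw : IsBM w) (hw' : IsBM w') {s : ℝ}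
    (h : ∀ x, w x - w' x ≤ s) (x : X) : bellman c T α w x - bellman c T α w' x ≤ α * s := by
  have : bellman c T α w x - α * s ≤ bellman c T α w' x := le_ciInf fun u => by
    have h1 : ∫ y, w y ∂(T (x, u)) - ∫ y, w' y ∂(T (x, u)) ≤ s := by
      rw [← integral_sub (hw.integrable _) (hw'.integrable _)]
      refine (integral_mono ((hw.sub hw').integrable _) (integrable_const s) h).trans_eq ?_
      simp
    have h2 := mul_le_mul_of_nonneg_left h1 hα
    linarith [bellman_le hc α hw x u (T := T)]
  linarith

-- Iterating the Bellman operator from `0` shrinks the residual by the factor `α` each time; a late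
-- iterate suffices and no exact fixed point is needed.
include hc hcc hT in
theorem exists_abs_bellman_sub_le {α : ℝ} (hα : 0 ≤ α) (hα1 : α < 1) {δ : ℝ} (hδ : 0 < δ) :
    ∃ w : X → ℝ, IsBM w ∧ ∀ x, |bellman c T α w x - w x| ≤ δ := by
  have hb {w : X → ℝ} (hw : IsBM w) : IsBM (bellman c T α w) :=
    (isBM_bellman_and_exists_near_selector hc hcc hT α hw).1
  obtain ⟨K, hK⟩ := (hb (IsBM.const 0)).bdd
  have key (k : ℕ) : ∃ w : X → ℝ, IsBM w ∧ ∀ x, |bellman c T α w x - w x| ≤ α ^ k * |K| := by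
    induction k with
    | zero => exact ⟨fun _ => 0, IsBM.const 0, fun x => by simpa using (hK x).trans (le_abs_self K)⟩
    | succ k ih =>
      obtain ⟨w, hw, h⟩ := ih
      refine ⟨_, hb hw, fun x => ?_⟩
      rw [pow_succ', mul_assoc]
      refine abs_sub_le_iff.2 ⟨?_, ?_⟩
      · exact bellman_sub_le hc hα (hb hw) hw (fun y => (abs_sub_le_iff.1 (h y)).1) x
      · exact bellman_sub_le hc hα hw (hb hw) (fun y => (abs_sub_le_iff.1 (h y)).2) x
  obtain ⟨k, hk⟩ := exists_pow_lt_of_lt_one (show 0 < δ / (|K| + 1) by positivity) hα1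
  obtain ⟨w, hw, h⟩ := key k
  refine ⟨w, hw, fun x => (h x).trans ?_⟩
  rw [lt_div_iff₀ (by positivity)] at hk
  nlinarith [pow_nonneg hα k]

include hc hcc hT in
/-- Approximate solutions of the average cost optimality equation, with a uniform bound, obtained
from discounted problems with discount factor close to `1`. -/
theorem exists_approx_acoe [Nonempty X] {t : ℕ} {β : ℝ} (hTe : ErgodicityCondition T t β)
    (hβ : 0 < β) (hβ1 : β < 1) :
    ∃ H : ℝ, ∀ δ > 0, ∃ (j : ℝ) (h : X → ℝ) (g : StationaryPolicy X U), IsBM h ∧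
      (∀ x, |h x| ≤ H) ∧ (∀ x u, h x + (j - δ) ≤ c x u + ∫ y, h y ∂(T (x, u))) ∧
      ∀ x, c x (g.act x) + op (closedLoop T g) h x ≤ h x + j + δ := by
  obtain ⟨K, hK⟩ := hc.bdd
  obtain ⟨x₀⟩ := ‹Nonempty X›
  set H := 2 * t * (|K| + 1) / (1 - β) with hH
  have hH0 : 0 ≤ H := div_nonneg (by positivity) (by linarith)
  refine ⟨H, fun δ hδ => ?_⟩
  -- The discount factor is `1 - ε`, with `ε` so small that replacing it by `1` costs at most `min δ
  -- 1 / 2`. The Bellman residual and the selector use a quarter each.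
  set ε := min δ 1 / (2 * (H + 1)) with hε
  have hm0 : 0 < min δ 1 := lt_min hδ one_pos
  have hε0 : 0 < ε := by positivity
  have hε1 : ε ≤ 1 := by
    rw [hε, div_le_one (by positivity)]
    linarith [min_le_right δ 1]
  have hεH : ε * H ≤ min δ 1 / 2 := by
    rw [hε, div_mul_eq_mul_div, div_le_iff₀ (by positivity)]
    nlinarith
  obtain ⟨w, hw, hwL⟩ := exists_abs_bellman_sub_le hc hcc hT (α := 1 - ε) (by linarith)
    (by linarith) (show 0 < min δ 1 / 4 by positivity)
  obtain ⟨g, hg⟩ := (isBM_bellman_and_exists_near_selector hc hcc hT (1 - ε) hw).2 (min δ 1 / 4)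
    (by positivity)
  -- The span bound does not involve the discount factor. Both approximation errors together stay
  -- below `1`, whence `|K| + 1`.
  have hspan := hTe.span_le hβ hβ1 g hw (α := 1 - ε) (j := 0) (D := |K| + 1) (by linarith)
    (by linarith) (fun x => by
      have h1 := abs_le.1 (hwL x)
      have h2 := hg x
      have h3 := bellman_le hc (1 - ε) hw x (g.act x) (T := T)
      rw [← op_closedLoop] at h3
      have h4 := abs_le.1 ((hK (x, g.act x)).trans (le_abs_self K))
      simp only [Function.uncurry_apply_pair] at h4
      have h5 := min_le_right δ 1
      exact abs_le.2 ⟨by linarith, by linarith⟩)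
  have hh : IsBM (fun x => w x - w x₀) := hw.sub (IsBM.const _)
  have hhH (x : X) : |w x - w x₀| ≤ H := abs_le.2 ⟨by linarith [hspan x₀ x], hspan x x₀⟩
  have hI (x : X) (u : U) : ∫ y, (w y - w x₀) ∂(T (x, u)) = ∫ y, w y ∂(T (x, u)) - w x₀ := by
    rw [integral_sub (hw.integrable _) (integrable_const _)]; simp
  have hIH (x : X) (u : U) : |ε * ∫ y, (w y - w x₀) ∂(T (x, u))| ≤ min δ 1 / 2 := by
    have := norm_integral_le_of_norm_le_const (μ := T (x, u)) (f := fun y => w y - w x₀)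
      (Eventually.of_forall hhH)
    rw [probReal_univ, mul_one, Real.norm_eq_abs] at this
    rw [abs_mul, abs_of_pos hε0]
    exact (mul_le_mul_of_nonneg_left this hε0.le).trans hεH
  have hmin := min_le_left δ 1
  -- Subtracting `w x₀` from both sides of the discounted equation leaves `ε * w x₀` as the average
  -- cost constant.
  refine ⟨ε * w x₀, _, g, hh, hhH, fun x u => ?_, fun x => ?_⟩
  · have h1 := bellman_le hc (1 - ε) hw x u (T := T)
    have h2 := abs_le.1 (hIH x u)
    have h3 := abs_le.1 (hwL x)
    rw [hI] at h2 ⊢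
    linarith
  · have h1 := hg x
    have h2 := abs_le.1 (hIH x (g.act x))
    have h3 := abs_le.1 (hwL x)
    rw [op_closedLoop] at h1
    rw [op_closedLoop, hI]
    rw [hI] at h2
    linarith

-- Normalizing `v` at one state turns the span estimate into a sup bound depending only on `K`, `t`
-- and `β`, hence uniform over the approximating models.
include hc in
omit [TopologicalSpace U] [FirstCountableTopology U] [TopologicalSpace.SeparableSpace U] [Nonempty U] in
theorem SatisfiesACOE.exists_bounded [Nonempty X] {K : ℝ} (hK : ∀ x u, |c x u| ≤ K)
    {g : StationaryPolicy X U} (hg : SatisfiesACOE c T g) {t : ℕ} {β : ℝ}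
    (hTe : ErgodicityCondition T t β) (hβ : 0 < β) (hβ1 : β < 1) :
    ∃ (j : ℝ) (v : X → ℝ), IsBM v ∧ (∀ x, |v x| ≤ 2 * t * K / (1 - β)) ∧
      (∀ x u, v x + j ≤ c x u + ∫ y, v y ∂(T (x, u))) ∧
      ∀ x, v x + j = c x (g.act x) + op (closedLoop T g) v x := by
  obtain ⟨j, v, hvm, hvb, hv⟩ := hg
  obtain ⟨x₀⟩ := ‹Nonempty X›
  have hvB : IsBM v := ⟨hvm, hvb⟩
  have hspan := hTe.span_le hβ hβ1 g hvB (α := 1) (j := j) (D := K) zero_le_one le_rfl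
    (fun x => by
      have h1 := (hv x).2
      have h2 := hK x (g.act x)
      rw [op_closedLoop]
      rwa [show v x - (1 * ∫ y, v y ∂(T (x, g.act x)) - j) = c x (g.act x) by linarith])
  have hI (x : X) (u : U) : ∫ y, (v y - v x₀) ∂(T (x, u)) = ∫ y, v y ∂(T (x, u)) - v x₀ := by
    rw [integral_sub (hvB.integrable _) (integrable_const _)]; simp
  refine ⟨j, fun x => v x - v x₀, hvB.sub (IsBM.const _),
    fun x => abs_le.2 ⟨by linarith [hspan x₀ x], hspan x x₀⟩, fun x u => ?_, fun x => ?_⟩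
  · have h1 := bellman_le hc 1 hvB x u (T := T)
    simp only [bellman, one_mul] at h1
    rw [hI]
    linarith [(hv x).1]
  · rw [op_closedLoop, hI]
    linarith [(hv x).2]

end ApproximateOptimality

/-! ### Transfer of optimality from the approximating kernels to the limit. -/

section Robustness

variable {X U : Type*} [MeasurableSpace X] [MeasurableSpace U] [TopologicalSpace U] [CompactSpace U]
  [FirstCountableTopology U] {T : Kernel (X × U) X} [IsMarkovKernel T]
  {c : X → U → ℝ} (hc : IsBM (Function.uncurry c)) {t : ℕ} {β : ℝ}

-- For `k ≥ t * p`, the `k`-step average of `ρ n` is an average of its `t * p`-step average, which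
-- is small at `x` for large `n` and oscillates by at most `ε / 2`. The earlier terms have a bounded
-- sum, which the time average removes.
include hc in
theorem eventually_avgCost_le (hT : SetwiseContConv (fun _ => T) T)
    (hTe : ErgodicityCondition T t β) (hβ : 0 < β) (hβ1 : β < 1) (γ : ℕ → StationaryPolicy X U)
    {h : X → ℝ} (hh : IsBM h) {ρ : ℕ → X → ℝ} (hρ : IsNull ρ) {j : ℝ}
    (hj : ∀ n x, c x ((γ n).act x) + op (closedLoop T (γ n)) h x ≤ h x + j + ρ n x) (x : X)
    {ε : ℝ} (hε : 0 < ε) : ∀ᶠ n in atTop, avgCost c T (γ n).toAdmissible x ≤ j + ε := by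
  obtain ⟨R, hR⟩ := hρ.bdd
  obtain ⟨C, hC⟩ := hh.bdd
  have hR0 : 0 ≤ R := (abs_nonneg _).trans (hR 0 x)
  obtain ⟨p, hp⟩ := exists_pow_lt_of_lt_one (show 0 < ε / 2 / (2 * R + 1) by positivity) hβ1
  have hp' : β ^ p * (2 * R) ≤ ε / 2 := by
    rw [lt_div_iff₀ (by positivity)] at hp
    nlinarith [pow_pos hβ p]
  have hlim := (hρ.op_stepKernel hT γ (t * p)).lim x
  filter_upwards [hlim.eventually (gt_mem_nhds (half_pos hε))] with n hn
  have hρn := hρ.isBM n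
  have hle (k : ℕ) : op (stepKernel T (γ n) k) (ρ n) x ≤ ε + if k < t * p then R else 0 := by
    split_ifs with hk
    · linarith [op_le (stepKernel T (γ n) k) hρn (fun y => (abs_le.1 (hR n y)).2) x]
    · obtain ⟨m, rfl⟩ := Nat.exists_eq_add_of_le (not_lt.1 hk)
      rw [add_comm (t * p) m, op_stepKernel_add _ _ hρn]
      have h1 := hTe.osc_pow_le (γ n) hρn (s := 2 * R) (fun y y' => by
        linarith [abs_le.1 (hR n y), abs_le.1 (hR n y')]) p
      have h2 := op_le (stepKernel T (γ n) m) (hρn.op (stepKernel T (γ n) (t * p)))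
        (r := ε) (fun y => by linarith [h1 y x]) x
      linarith
  refine avgCost_le hc T _ x (C := C + C + (t * p : ℕ) * R) fun N => ?_
  have h1 := finiteCost_stationary_add_le hc T (γ n) hh hρn (hj n) x N
  have h2 := abs_le.1 (abs_op_le (stepKernel T (γ n) N) hh hC x)
  have h3 := Finset.sum_le_sum fun k (_ : k ∈ Finset.range N) => hle k
  rw [Finset.sum_add_distrib, ← Finset.sum_filter, Finset.sum_const, Finset.sum_const,
    nsmul_eq_mul, nsmul_eq_mul, Finset.card_range] at h3
  have h4 : ((Finset.filter (fun k => k < t * p) (Finset.range N)).card : ℝ) ≤ (t * p : ℕ) := by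
    have := Finset.card_le_card (show Finset.filter (fun k => k < t * p) (Finset.range N)
      ⊆ Finset.range (t * p) from fun k hk => by simp at hk ⊢; exact hk.2)
    rw [Finset.card_range] at this
    exact_mod_cast this
  have h5 := mul_le_mul_of_nonneg_right h4 hR0
  linarith [(abs_le.1 (hC x)).2]

variable {S : ℕ → Kernel (X × U) X} [∀ n, IsMarkovKernel (S n)]

/-- A bounded function cannot drift: over `N` steps, `-N * κ n` is at most `2 * F` plus a null term,
and `N` is chosen beyond `(2 * F + 1) / δ`. -/
theorem eventually_le_of_le_op_closedLoop (hS : SetwiseContConv S T) (g : ℕ → StationaryPolicy X U)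
    {f e : ℕ → X → ℝ} (hf : ∀ n, IsBM (f n)) {F : ℝ} (hF : ∀ n x, |f n x| ≤ F) (he : IsNull e)
    {κ : ℕ → ℝ} (hfe : ∀ n x, f n x ≤ op (closedLoop (S n) (g n)) (f n) x + κ n + e n x) (x : X)
    {δ : ℝ} (hδ : 0 < δ) : ∀ᶠ n in atTop, - κ n ≤ δ := by
  obtain ⟨N, hN⟩ := exists_nat_gt ((2 * F + 1) / δ)
  have hF0 : 0 ≤ F := (abs_nonneg _).trans (hF 0 x)
  have hN0 : (0 : ℝ) < N := lt_of_le_of_lt (by positivity) hN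
  rw [div_lt_iff₀ hδ] at hN
  obtain ⟨r, hr, h⟩ := exists_isNull_le_op_stepKernel hS g hf he hfe N
  filter_upwards [(hr.lim x).eventually (gt_mem_nhds one_pos)] with n hn
  have h1 := h n x
  have h2 := (abs_le.1 (abs_op_le (stepKernel (S n) (g n) N) (hf n) (hF n) x)).2
  have h3 := (abs_le.1 (hF n x)).1
  refine le_of_mul_le_mul_left ?_ hN0
  linarith

/-- The excess of the policies `γ n`, which are optimal for the kernels `S n`, in an approximate
optimality equation for the limiting kernel `T`. -/
theorem exists_isNull_excess (hS : SetwiseContConv S T) (hT : SetwiseContConv (fun _ => T) T)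
    (hSe : ∀ n, ErgodicityCondition (S n) t β) (hβ : 0 < β) (hβ1 : β < 1)
    (γ : ℕ → StationaryPolicy X U) {v : ℕ → X → ℝ} {jn : ℕ → ℝ} (hv : ∀ n, IsBM (v n)) {V : ℝ}
    (hV : ∀ n x, |v n x| ≤ V) (hvle : ∀ n x u, v n x + jn n ≤ c x u + ∫ y, v n y ∂(S n (x, u)))
    (hveq : ∀ n x, v n x + jn n = c x ((γ n).act x) + op (closedLoop (S n) (γ n)) (v n) x)
    {h : X → ℝ} {j H δ : ℝ} {g : StationaryPolicy X U} (hh : IsBM h) (hH : ∀ x, |h x| ≤ H)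
    (hhle : ∀ x u, h x + (j - δ) ≤ c x u + ∫ y, h y ∂(T (x, u)))
    (hhg : ∀ x, c x (g.act x) + op (closedLoop T g) h x ≤ h x + j + δ) (hδ : 0 < δ) (x : X) (p : ℕ)
    {η : ℝ} (hη : η = β ^ p * (2 * (V + H)) + t * p * (3 * δ)) :
    ∃ ρ : ℕ → X → ℝ, IsNull ρ ∧ ∀ n y,
      c y ((γ n).act y) + op (closedLoop T (γ n)) h y
        ≤ h y + (j + 2 * δ + ((4 * 3 ^ t * η + 2 * 3 ^ t * (3 * δ)) / (1 - β) + 2 * η)) + ρ n y := by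
  set f : ℕ → X → ℝ := fun n y => v n y - h y with hf
  have hfB (n : ℕ) : IsBM (f n) := (hv n).sub hh
  have hfF (n : ℕ) (y : X) : |f n y| ≤ V + H :=
    (abs_sub _ _).trans (add_le_add (hV n y) (hH y))
  have he := hS.isNull_sub hT (fun _ => g) hh
  have he' := hS.isNull_sub hT γ hh
  have hup (n : ℕ) (y : X) : f n y ≤ op (closedLoop (S n) g) (f n) y + (j - jn n + δ)
      + |op (closedLoop (S n) g) h y - op (closedLoop T g) h y| := by
    have h1 := hvle n y (g.act y)
    have h2 := hhg y
    have h3 := le_abs_self (op (closedLoop (S n) g) h y - op (closedLoop T g) h y)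
    rw [← op_closedLoop] at h1
    rw [hf, op_sub _ (hv n) hh]
    linarith
  have hlo (n : ℕ) (y : X) : op (closedLoop (S n) (γ n)) (f n) y ≤ f n y + (jn n - j + δ)
      + |op (closedLoop (S n) (γ n)) h y - op (closedLoop T (γ n)) h y| := by
    have h1 := hveq n y
    have h2 := hhle y ((γ n).act y)
    have h3 := neg_abs_le (op (closedLoop (S n) (γ n)) h y - op (closedLoop T (γ n)) h y)
    rw [← op_closedLoop] at h2
    rw [hf, op_sub _ (hv n) hh]
    linarith
  -- The no-drift bound for `f n` and for `-f n` gives `|jn n - j| ≤ 2 * δ` eventually. The positive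
  -- part is therefore eventually zero, and adding it to the null errors makes the drift bound `3 *
  -- δ` valid for every `n`.
  have hd : IsNull (fun n (_ : X) => max 0 (|jn n - j| - 2 * δ)) := by
    refine IsNull.of_real (tendsto_const_nhds.congr' ?_)
    filter_upwards [eventually_le_of_le_op_closedLoop hS (fun _ => g) hfB hfF he hup x hδ,
      eventually_le_of_le_op_closedLoop hS γ (f := fun n y => - f n y)
        (κ := fun n => jn n - j + δ) (fun n => (hfB n).neg)
        (fun n y => by rw [abs_neg]; exact hfF n y) he'
        (fun n y => by rw [op_neg]; linarith [hlo n y]) x hδ] with n h1 h2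
    have : |jn n - j| ≤ 2 * δ := abs_le.2 ⟨by linarith, by linarith⟩
    rw [max_eq_left (by linarith)]
  have hjn (n : ℕ) : |jn n - j| ≤ 2 * δ + max 0 (|jn n - j| - 2 * δ) := by
    linarith [le_max_right 0 (|jn n - j| - 2 * δ)]
  have hd0 (n : ℕ) : 0 ≤ max 0 (|jn n - j| - 2 * δ) := le_max_left _ _
  obtain ⟨ρ, hρ, h1⟩ := exists_isNull_sub_op_le hS hSe hβ hβ1 (fun _ => g) γ hfB hfF
    ((he.add he').add hd) (fun n y => by have := hd0 n; positivity) (κ := 3 * δ) (by positivity)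
    (fun n y => by
      have h1 := abs_le.1 (hjn n)
      have h2 := abs_nonneg (op (closedLoop (S n) (γ n)) h y - op (closedLoop T (γ n)) h y)
      linarith [hup n y])
    (fun n y => by
      have h1 := abs_le.1 (hjn n)
      have h2 := abs_nonneg (op (closedLoop (S n) g) h y - op (closedLoop T g) h y)
      linarith [hlo n y]) x p hη
  refine ⟨_, (hρ.add hd).add he', fun n y => ?_⟩
  have h2 := h1 n y
  have h3 := hveq n y
  have h4 := neg_abs_le (op (closedLoop (S n) (γ n)) h y - op (closedLoop T (γ n)) h y)
  have h5 := abs_le.1 (hjn n)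
  rw [hf, op_sub _ (hv n) hh] at h2
  linarith

include hc in
theorem tendsto_avgCost_of_satisfiesACOE [TopologicalSpace.SeparableSpace U]
    (hcc : ∀ x, Continuous (c x)) (hS : SetwiseContConv S T) (hT : SetwiseContConv (fun _ => T) T)
    (hSe : ∀ n, ErgodicityCondition (S n) t β) (hTe : ErgodicityCondition T t β)
    (hβ : 0 < β) (hβ1 : β < 1) (γ : ℕ → StationaryPolicy X U)
    (hγ : ∀ n, SatisfiesACOE c (S n) (γ n)) (x : X) :
    Tendsto (fun n => avgCost c T (γ n).toAdmissible x) atTop (𝓝 (optAvgCost c T x)) := by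
  have : Nonempty X := ⟨x⟩
  have : Nonempty U := ⟨(γ 0).act x⟩
  have : Nonempty (AdmissiblePolicy X U) := ⟨(γ 0).toAdmissible⟩
  obtain ⟨K, hK⟩ := hc.bdd
  choose jn v hv hV hvle hveq using fun n =>
    (hγ n).exists_bounded hc (fun x u => hK (x, u)) (hSe n) hβ hβ1
  obtain ⟨H, hHδ⟩ := exists_approx_acoe hc hcc hT hTe hβ hβ1
  set V := 2 * t * K / (1 - β)
  have hV0 : 0 ≤ V := (abs_nonneg _).trans (hV 0 x)
  have hH0 : 0 ≤ H := by
    obtain ⟨-, h, -, -, hH, -⟩ := hHδ 1 one_pos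
    exact (abs_nonneg _).trans (hH x)
  -- The lower bound is immediate, since each `γ n` competes in the infimum; only the upper bound
  -- needs work.
  refine tendsto_order.2 ⟨fun r hr => Eventually.of_forall fun n =>
    hr.trans_le (optAvgCost_le hc T _ x), fun r hr => ?_⟩
  set ε := r - optAvgCost c T x with hε
  have hε0 : 0 < ε := sub_pos.2 hr
  set A := 4 * 3 ^ t / (1 - β) + 2 with hA
  set B := 6 * 3 ^ t / (1 - β) with hB
  have hβ' : 0 < 1 - β := by linarith
  have hA0 : 0 < A := by positivity
  have hB0 : 0 < B := by positivity
  -- `p` is fixed before `δ`, because the accumulated drift `t * p * (3 * δ)` depends on it. This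
  -- requires `V` and `H` to be independent of `δ`.
  obtain ⟨p, hp⟩ := exists_pow_lt_of_lt_one
    (show 0 < ε / 4 / (A * (2 * (V + H)) + 1) by positivity) hβ1
  rw [lt_div_iff₀ (by positivity)] at hp
  have hp0 := pow_pos hβ p
  -- `D` collects the coefficients of `δ`: two in the excess, one in the lower bound `j - δ` of the
  -- optimal cost, and those from `A * η` and `B * δ`.
  set D := 3 + A * (t * p * 3) + B with hD
  have hD0 : 0 < D := by positivity
  obtain ⟨j, h, g, hh, hH, hhle, hhg⟩ := hHδ (ε / 4 / D) (by positivity)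
  have hδ : 0 < ε / 4 / D := by positivity
  have hDδ : D * (ε / 4 / D) = ε / 4 := by field_simp
  set δ := ε / 4 / D
  obtain ⟨ρ, hρ, hex⟩ := exists_isNull_excess hS hT hSe hβ hβ1 γ hv hV hvle hveq hh hH hhle hhg hδ x
    p rfl
  have hopt := le_optAvgCost hc T x hh hhle
  filter_upwards [eventually_avgCost_le hc hT hTe hβ hβ1 γ hh hρ hex x
    (show 0 < ε / 4 by positivity)] with n hn
  refine hn.trans_lt ?_
  set η := β ^ p * (2 * (V + H)) + t * p * (3 * δ) with hη
  have e1 : (4 * 3 ^ t * η + 2 * 3 ^ t * (3 * δ)) / (1 - β) + 2 * η = A * η + B * δ := by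
    rw [hA, hB]; ring
  have e2 : A * η + B * δ + 3 * δ = A * (2 * (V + H)) * β ^ p + D * δ := by
    rw [hη, hD]; ring
  rw [e1]
  linarith

end Robustness

end AvgMDP

theorem mainTheorem3 {d m : ℕ}
    (X : Set (EuclideanSpace ℝ (Fin d))) (hX : MeasurableSet X)
    (U : Set (EuclideanSpace ℝ (Fin m))) (hU : IsCompact U)
    (c : X → U → ℝ) (hc_meas : Measurable (Function.uncurry c))
    (hc_bdd : ∃ K : ℝ, ∀ x u, |c x u| ≤ K)
    (hc_cont : ∀ x, Continuous (c x))
    (T : Kernel (X × U) X) [IsMarkovKernel T]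
    (Tn : ℕ → Kernel (X × U) X) [∀ n, IsMarkovKernel (Tn n)]
    (t : ℕ) (ht : 0 < t) (β : ℝ) (hβ_pos : 0 < β) (hβ_lt : β < 1)
    (hT_erg : AvgMDP.ErgodicityCondition T t β)
    (hTn_erg : ∀ n, AvgMDP.ErgodicityCondition (Tn n) t β)
    (hT_cont : ∀ (x : X) (w : ℕ → U) (u : U), Tendsto w atTop (𝓝 u) →
      AvgMDP.SetwiseTendsto (fun n => T (x, w n)) (T (x, u)))
    (h_conv : ∀ (x : X) (w : ℕ → U) (u : U), Tendsto w atTop (𝓝 u) →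
      AvgMDP.SetwiseTendsto (fun n => Tn n (x, w n)) (T (x, u)))
    (γ : ℕ → AvgMDP.StationaryPolicy X U)
    (hγ : ∀ n, AvgMDP.SatisfiesACOE c (Tn n) (γ n)) :
    ∀ x : X, Tendsto (fun n => AvgMDP.avgCost c T (γ n).toAdmissible x) atTop
      (𝓝 (AvgMDP.optAvgCost c T x)) := by
  have : CompactSpace U := isCompact_iff_compactSpace.1 hU
  obtain ⟨K, hK⟩ := hc_bdd
  exact AvgMDP.tendsto_avgCost_of_satisfiesACOE ⟨hc_meas, K, fun p => hK p.1 p.2⟩ hc_cont h_conv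
    hT_cont hTn_erg hT_erg hβ_pos hβ_lt γ hγ
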